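/- Let $G$ be a (real, finite-dimensional, Hausdorff, second countable) Lie group of dimension $d\ge 1$ with Lie algebra $\mathfrak g$, let $\Gamma<G$ be a lattice, $X=G/\Gamma$, and let $\mu$ be the $G$-invariant Borel probability measure on $X$. Fix a right-invariant Riemannian metric on $G$; the distance $\mathbf d(x,y)$ on $X$ is the infimum of the Riemannian distances between representatives of $x$ and $y$ in $G$. Let $(a_t)_{t\in\mathbb R}$ be a one-parameter subgroup of $G$ such that $\mathrm{Ad}(a_t)$ is diagonalizable: there are a basis $\zeta_1,\dots,\zeta_d$ of $\mathfrak g$ and $\gamma_1,\dots,\gamma_d\in\mathbb R$ with $\mathrm{Ad}(a_t)\zeta_i=e^{\gamma_i t}\zeta_i$ for all $t$. Put $\gamma=\max_i\gamma_i$. For $f:X\to\mathbb R$ let $D_{\zeta}f(x)=\frac{d}{dt}f(\exp(t\zeta)x)|_{t=0}$; let $W^{(2,k)}(X)$ be the set of $f$ whose iterated derivatives $D_{\zeta_{n_1}}\cdots D_{\zeta_{n_j}}f$, $0\le j\le k$, exist everywhere and lie in $L^2(\mu)$, and put $$S_k(f)^2=\|f\|_2^2+\sum_{j=1}^k\sum_{n_1,\dots,n_j=1}^d\|D_{\zeta_{n_1}}\cdots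 D_{\zeta_{n_j}}f\|_2^2 .$$ Assume exponential decay of correlations: for some integer $k\ge 1$ and some $\delta>0$ there is $c>0$ such that for all $f,g\in W^{(2,k)}(X)$ and all $t\ge 0$ $$\Big|\int_X f(x)g(a_tx)\,d\mu(x)-\int_X f\,d\mu\int_X g\,d\mu\Big|\le c\,e^{-\delta t}S_k(f)S_k(g).$$ Let $(m_j)_{j\ge 0}$ be a sequence of positive real numbers with $$\rho^{-1}:=\sup_{s\ge 1}\frac{m_{s-1}}{m_s}<\min\Big(1,\frac{\delta}{k\gamma}\Big),$$ where $\gamma>0$. Let $\alpha_n<\beta_n$ be natural numbers with $\alpha_n\to\infty$ and $\beta_n-\alpha_n\to\infty$, put $N_n=\beta_n-\alpha_n+1$, let $l\ge 1$ be an integer, and assume $$N_n=o\big(e^{\sigma\rho^{\alpha_n}}\big),\qquad \sigma=\frac{-m_0}{\frac12 l+k-1}\Big(\frac{k\gamma}{\rho}-\delta\Big)>0 .$$ Let $\mathcal D:X\to\mathbb R$ be measurable, let $M^{(l)}_{I_n}(x)$ be the $l$-th largest (with multiplicity) of the numbers $\mathcal D(a_{m_j}x)$, $\alpha_n\le j\le\beta_n$,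 and let $\Phi_{\mathcal D}(z)=\mu\{x:\mathcal D(x)\ge z\}$. For $v>0$ and $r\in\mathbb R$ put $u_n(r)=r+\frac1v\log N_n$. **A)** Let $w,v>0$ and suppose that $\mathcal D$ is $(w,v)$-strong-distance-like, i.e. uniformly continuous with respect to $\mathbf d$ with $\Phi_{\mathcal D}(z)=we^{-vz}+o(e^{-vz})$ as $z\to\infty$. Then for every $r\in\mathbb R$ $$\lim_{n\to\infty}\mu\big(M^{(l)}_{I_n}\le u_n(r)\big)=e^{-we^{-vr}}\sum_{i=0}^{l-1}\frac{(we^{-vr})^i}{i!}.$$ **B)** Let $w_1,w_2,v>0$ and suppose that $\mathcal D$ is $(w_1,w_2,v)$-distance-like, i.e. uniformly continuous with respect to $\mathbf d$ with $w_1e^{-vz}\le\Phi_{\mathcal D}(z)\le w_2e^{-vz}$ for all sufficiently large $z$. Then for every $r\in\mathbb R$ $$e^{-w_2e^{-vr}}\sum_{i=0}^{l-1}\frac{(w_1e^{-vr})^i}{i!}\le\liminf_{n\to\infty}\mu\big(M^{(l)}_{I_n}\le u_n(r)\big)\le\limsup_{n\to\infty}\mu\big(M^{(l)}_{I_n}\le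 u_n(r)\big)\le e^{-w_1e^{-vr}}\sum_{i=0}^{l-1}\frac{(w_2e^{-vr})^i}{i!}.$$ -/

import Mathlib

open Set Filter Topology MeasureTheory Bundle
open scoped ENNReal Manifold ContDiff

noncomputable section HomogeneousEVD

section LieTheory

variable {E : Type*} [NormedAddCommGroup E] [NormedSpace ℝ E]
  {G : Type*} [TopologicalSpace G] [ChartedSpace E G] [Group G]

/-- The one-parameter subgroup `φ : ℝ → G` has velocity `v` at time `0`. -/
def HasInitialVelocity (φ : Multiplicative ℝ →ₜ* G) (v : GroupLieAlgebra 𝓘(ℝ, E) G) : Prop :=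
  HasMFDerivAt 𝓘(ℝ, ℝ) 𝓘(ℝ, E) (fun t : ℝ => φ (Multiplicative.ofAdd t)) 0
    (ContinuousLinearMap.toSpanSingleton ℝ (show E from v))

open Classical in
/-- The exponential map of a Lie group: `lieExp v = φ 1` for the one-parameter subgroup `φ` with
velocity `v` at `0`. In a Lie group such a `φ` exists and is unique, so that the
second branch is never used. -/
def lieExp (v : GroupLieAlgebra 𝓘(ℝ, E) G) : G :=
  if h : ∃ φ : Multiplicative ℝ →ₜ* G, HasInitialVelocity φ v then
    h.choose (Multiplicative.ofAdd 1)
  else 1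

/-- The adjoint action `Ad g` on the Lie algebra: the derivative at the identity of
`h ↦ g * h * g⁻¹`. (All tangent spaces are modelled on `E`, and `g * 1 * g⁻¹ = 1`.) -/
def lieAd (g : G) (v : GroupLieAlgebra 𝓘(ℝ, E) G) : GroupLieAlgebra 𝓘(ℝ, E) G :=
  (show E from mfderiv 𝓘(ℝ, E) 𝓘(ℝ, E) (fun h : G => g * h * g⁻¹) 1 v)

section Metric

variable [FiniteDimensional ℝ E] [LieGroup 𝓘(ℝ, E) ∞ G]

/-- A smooth Riemannian metric on the Lie group `G`. -/
abbrev LieRiemannianMetric (E : Type*) [NormedAddCommGroup E] [NormedSpace ℝ E]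
    (G : Type*) [TopologicalSpace G] [ChartedSpace E G] [Group G] [LieGroup 𝓘(ℝ, E) ∞ G] :=
  ContMDiffRiemannianMetric 𝓘(ℝ, E) ∞ E (fun g : G => TangentSpace 𝓘(ℝ, E) g)

/-- The Riemannian metric is invariant under all right translations `x ↦ x * h`. -/
def IsRightInvariantMetric (gm : LieRiemannianMetric E G) : Prop :=
  ∀ (h x : G) (v w : TangentSpace 𝓘(ℝ, E) x),
    gm.inner (x * h) (mfderiv 𝓘(ℝ, E) 𝓘(ℝ, E) (fun y : G => y * h) x v)
      (mfderiv 𝓘(ℝ, E) 𝓘(ℝ, E) (fun y : G => y * h) x w) = gm.inner x v w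

/-- The Riemannian distance on `G`: infimum of the lengths of `C^1` paths. It is `∞` between
different connected components. -/
def lieDist (gm : LieRiemannianMetric E G) (g h : G) : ℝ≥0∞ :=
  letI : RiemannianBundle (fun g : G => TangentSpace 𝓘(ℝ, E) g) := ⟨gm.toRiemannianMetric⟩
  Manifold.riemannianEDist 𝓘(ℝ, E) g h

/-- The distance on `G ⧸ Γ` induced by the (right-invariant) Riemannian metric of `G`: the infimum
of the distances between representatives. -/
def quotientDist (gm : LieRiemannianMetric E G) (Γ : Subgroup G) (x y : G ⧸ Γ) : ℝ≥0∞ :=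
  ⨅ (g : G) (h : G) (_ : (g : G ⧸ Γ) = x) (_ : (h : G ⧸ Γ) = y), lieDist gm g h

end Metric

section Sobolev

variable {X : Type*} [MulAction G X]

/-- `f` is differentiable at every point along `t ↦ exp (t v) • x`. -/
def HasLieDerivative (v : GroupLieAlgebra 𝓘(ℝ, E) G) (f : X → ℝ) : Prop :=
  ∀ x : X, DifferentiableAt ℝ (fun t : ℝ => f (lieExp (t • v) • x)) 0

/-- The derivative `D_v f (x) = d/dt f (exp (t v) x)` at `t = 0`. -/
def lieDerivative (v : GroupLieAlgebra 𝓘(ℝ, E) G) (f : X → ℝ) (x : X) : ℝ :=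
  deriv (fun t : ℝ => f (lieExp (t • v) • x)) 0

variable {d : ℕ} (ζ : Module.Basis (Fin d) ℝ (GroupLieAlgebra 𝓘(ℝ, E) G))

/-- The iterated derivative `D_{ζ_{n₁}} ⋯ D_{ζ_{n_l}} f` for the word `[n₁, …, n_l]`. -/
def iterLieDerivative : List (Fin d) → (X → ℝ) → X → ℝ
  | [], f => f
  | i :: w, f => lieDerivative (ζ i) (iterLieDerivative w f)

variable [MeasurableSpace X] (μ : Measure X)

/-- Membership in the Sobolev space `W^(2,k)(X)`: all the derivatives of order at most `k` in the
directions of the basis exist and belong to `L²`. -/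
def MemSobolev (k : ℕ) (f : X → ℝ) : Prop :=
  (∀ w : List (Fin d), w.length < k → ∀ i, HasLieDerivative (ζ i) (iterLieDerivative ζ w f)) ∧
  (∀ w : List (Fin d), w.length ≤ k → MemLp (iterLieDerivative ζ w f) 2 μ)

/-- The Sobolev norm `S_k f`; the summand for `l = 0` is `‖f‖₂²`. -/
def sobolevNorm (k : ℕ) (f : X → ℝ) : ℝ :=
  Real.sqrt (∑ l ∈ Finset.range (k + 1), ∑ n : Fin l → Fin d,
    ∫ x, (iterLieDerivative ζ (List.ofFn n) f x) ^ 2 ∂μ)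

/-- Exponential decay of correlations with exponent `δ` against `W^(2,k)` Sobolev observables. -/
def ExpDecayOfCorrelations (a : Multiplicative ℝ →ₜ* G) (k : ℕ) (δ : ℝ) : Prop :=
  ∃ c : ℝ, 0 < c ∧ ∀ f g : X → ℝ, MemSobolev ζ μ k f → MemSobolev ζ μ k g →
    ∀ t : ℝ, 0 ≤ t →
      |(∫ x, f x * g (a (Multiplicative.ofAdd t) • x) ∂μ) - (∫ x, f x ∂μ) * ∫ x, g x ∂μ|
        ≤ c * Real.exp (-δ * t) * sobolevNorm ζ μ k f * sobolevNorm ζ μ k g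

end Sobolev

end LieTheory

section Observables

variable {X : Type*}

/-- Uniform continuity of a real function with respect to an extended distance. -/
def UnifContWrt (dist : X → X → ℝ≥0∞) (D : X → ℝ) : Prop :=
  ∀ ε : ℝ, 0 < ε → ∃ η : ℝ≥0∞, 0 < η ∧ ∀ x y : X, dist x y < η → |D x - D y| < ε

variable [MeasurableSpace X]

/-- The tail distribution function `Φ_D z = μ {x | D x ≥ z}`. -/
def tailDist (μ : Measure X) (D : X → ℝ) (z : ℝ) : ℝ := μ.real {x | z ≤ D x}

/-- `(w₁, w₂, v)`-distance-like observables. -/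
def IsDL (dist : X → X → ℝ≥0∞) (μ : Measure X) (w₁ w₂ v : ℝ) (D : X → ℝ) : Prop :=
  UnifContWrt dist D ∧ ∀ᶠ z in atTop,
    w₁ * Real.exp (-v * z) ≤ tailDist μ D z ∧ tailDist μ D z ≤ w₂ * Real.exp (-v * z)

/-- `(w, v)`-strong-distance-like observables. -/
def IsSDL (dist : X → X → ℝ≥0∞) (μ : Measure X) (w v : ℝ) (D : X → ℝ) : Prop :=
  UnifContWrt dist D ∧
    (fun z => tailDist μ D z - w * Real.exp (-v * z)) =o[atTop] fun z => Real.exp (-v * z)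

end Observables

/-- The `l`-th largest (`l ≥ 1`) of the numbers `ξ j`, `j ∈ s`, counted with multiplicity: entry
number `l` of the list sorted in decreasing order (and `0` if `l` exceeds the size of `s`). -/
def kthLargest {ι : Type*} (s : Finset ι) (ξ : ι → ℝ) (l : ℕ) : ℝ :=
  ((s.val.map ξ).sort (· ≥ ·)).getD (l - 1) 0

/-- `M^(l)_{I_n}(x)`, the `l`-th largest of `D (a_{m_j} x)` for `j = α, …, β`. -/
def orbitMax {G X : Type*} [TopologicalSpace G] [Group G] [MulAction G X]
    (a : Multiplicative ℝ →ₜ* G) (D : X → ℝ) (m : ℕ → ℝ) (α β l : ℕ) (x : X) : ℝ :=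
  kthLargest (Finset.Icc α β) (fun j => D (a (Multiplicative.ofAdd (m j)) • x)) l

/-- The number `N = β - α + 1` of indices between `α` and `β`. -/
def blockLength (α β : ℕ) : ℝ := (β : ℝ) - (α : ℝ) + 1

/-- The threshold `u_n(r) = r + (1 / v) log N_n`, where `N_n = β_n - α_n + 1`. -/
def threshold (v r : ℝ) (α β : ℕ) : ℝ := r + 1 / v * Real.log (blockLength α β)

end HomogeneousEVD

/-! The `l`-th largest value is at most `u` exactly when fewer than `l` of the events `D (a_{m_j} x)
> u` occur. The indicator of this is `bernoulliCdf` evaluated at the indicators of the events: a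
polynomial affine in each variable and antitone on the unit cube, whose value at a constant `p` is a
binomial distribution function.

The indicators are replaced by smooth functions `f` squeezed between nearby level sets of `D`. Since
`D` is uniformly continuous for a distance coming from a right-invariant metric, small left
translations change it uniformly little, so averaging an indicator against a fixed bump on `G` gives
such an `f` with derivative bounds independent of the level
(`UnifContWrt.exists_derivBound_between`).

For smooth `f` the factors are peeled off from the last one. The factors before time `m_j` together
have derivatives of order at most `k` bounded by `K ^ j * exp (k γ m_{j-1})`, and `m_{j-1} ≤ m_j /
ρ`. Mixing at time `m_j` therefore costs at most a constant times `K ^ j * exp (-(δ - k γ / ρ)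
m_j)`. As `m_j ≥ m_0 ρ ^ j`, these errors are summable, and their tail from `α` on tends to `0`
(`exists_tendsto_bernoulliCdf_error`). What remains is a binomial law with `N p` pinched by the tail
of `D`, hence the Poisson bounds; the width `η` of the approximation tends to `0` last. -/

/-! ### One-parameter subgroups and the exponential map. -/

section OneParameter

variable {E : Type*} [NormedAddCommGroup E] [NormedSpace ℝ E]
  {G : Type*} [TopologicalSpace G] [ChartedSpace E G] [Group G]

/-- The one-parameter subgroup `t ↦ φ (c * t)`. -/
noncomputable def oneParamRescale (c : ℝ) (φ : Multiplicative ℝ →ₜ* G) :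
    Multiplicative ℝ →ₜ* G where
  toFun t := φ (Multiplicative.ofAdd (c * Multiplicative.toAdd t))
  map_one' := by simp
  map_mul' s t := by
    rw [← map_mul, ← ofAdd_add, toAdd_mul, mul_add]
  continuous_toFun := by
    have h : Continuous fun t : Multiplicative ℝ => c * Multiplicative.toAdd t :=
      continuous_const.mul continuous_toAdd
    exact φ.continuous_toFun.comp (continuous_ofAdd.comp h)

theorem oneParamRescale_apply (c : ℝ) (φ : Multiplicative ℝ →ₜ* G) (t : ℝ) :
    oneParamRescale c φ (Multiplicative.ofAdd t) = φ (Multiplicative.ofAdd (c * t)) := rfl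

theorem HasInitialVelocity.rescale {φ : Multiplicative ℝ →ₜ* G} {v : GroupLieAlgebra 𝓘(ℝ, E) G}
    (h : HasInitialVelocity φ v) (c : ℝ) : HasInitialVelocity (oneParamRescale c φ) (c • v) := by
  have h0 : HasMFDerivAt 𝓘(ℝ, ℝ) 𝓘(ℝ, ℝ) (fun t : ℝ => c * t) 0
      (ContinuousLinearMap.toSpanSingleton ℝ c) := by
    have h := ((hasDerivAt_id (0 : ℝ)).const_mul c).hasFDerivAt
    rw [mul_one] at h
    exact h.hasMFDerivAt
  have h1 : HasMFDerivAt 𝓘(ℝ, ℝ) 𝓘(ℝ, E) (fun t : ℝ => φ (Multiplicative.ofAdd t)) (c * 0)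
    (ContinuousLinearMap.toSpanSingleton ℝ (show E from v)) := by
    rw [mul_zero]; exact h
  have h2 := HasMFDerivAt.comp (0 : ℝ) h1 h0
  refine h2.congr_mfderiv ?_
  ext
  change ((1 : ℝ) • c) • (show E from v) = (1 : ℝ) • (c • (show E from v))
  simp

theorem hasInitialVelocity_one :
    HasInitialVelocity (1 : Multiplicative ℝ →ₜ* G) (0 : GroupLieAlgebra 𝓘(ℝ, E) G) := by
  have := hasMFDerivAt_const (I := 𝓘(ℝ, ℝ)) (I' := 𝓘(ℝ, E)) (1 : G) (0 : ℝ)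
  refine this.congr_mfderiv ?_
  ext
  change (0 : E) = (1 : ℝ) • (0 : E)
  simp

variable [LieGroup 𝓘(ℝ, E) ∞ G]

/-- The one-parameter subgroup `t ↦ g * φ t * g⁻¹`. -/
noncomputable def oneParamConj (g : G) (φ : Multiplicative ℝ →ₜ* G) : Multiplicative ℝ →ₜ* G where
  toMonoidHom := (MulAut.conj g).toMonoidHom.comp φ.toMonoidHom
  continuous_toFun := by
    have := topologicalGroup_of_lieGroup 𝓘(ℝ, E) ∞ (G := G)
    exact (continuous_const.mul φ.continuous_toFun).mul continuous_const

theorem oneParamConj_apply (g : G) (φ : Multiplicative ℝ →ₜ* G) (t : Multiplicative ℝ) :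
    oneParamConj (E := E) g φ t = g * φ t * g⁻¹ := rfl

theorem HasInitialVelocity.conj {φ : Multiplicative ℝ →ₜ* G} {v : GroupLieAlgebra 𝓘(ℝ, E) G}
    (h : HasInitialVelocity φ v) (g : G) :
    HasInitialVelocity (oneParamConj (E := E) g φ) (lieAd g v) := by
  have hs : ContMDiff 𝓘(ℝ, E) 𝓘(ℝ, E) ∞ (fun h : G => g * h * g⁻¹) :=
    (contMDiff_const.mul contMDiff_id).mul contMDiff_const
  -- `φ 0 = 1` holds only propositionally while the tangent space depends on the base point, so the
  -- derivative is stated at an arbitrary `x` with `x = 1`.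
  have key : ∀ x : G, x = 1 → HasMFDerivAt 𝓘(ℝ, E) 𝓘(ℝ, E) (fun h : G => g * h * g⁻¹) x
      (show E →L[ℝ] E from mfderiv 𝓘(ℝ, E) 𝓘(ℝ, E) (fun h : G => g * h * g⁻¹) 1) := by
    rintro x rfl
    exact (hs.mdifferentiable (by simp) 1).hasMFDerivAt
  have h2 := HasMFDerivAt.comp (0 : ℝ) (key (φ (Multiplicative.ofAdd 0)) (map_one φ)) h
  refine h2.congr_mfderiv ?_
  ext
  change (show E →L[ℝ] E from mfderiv 𝓘(ℝ, E) 𝓘(ℝ, E) (fun h : G => g * h * g⁻¹) 1)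
    ((1 : ℝ) • (show E from v)) = (1 : ℝ) •
      (show E →L[ℝ] E from mfderiv 𝓘(ℝ, E) 𝓘(ℝ, E) (fun h : G => g * h * g⁻¹) 1) v
  rw [one_smul, one_smul]

/-- Since `φ s = φ t * φ (s - t)`, the velocity at `t` is the left translate of `v`. Uniqueness of
`φ` then reduces to uniqueness of integral curves. -/
theorem HasInitialVelocity.isMIntegralCurve {φ : Multiplicative ℝ →ₜ* G}
    {v : GroupLieAlgebra 𝓘(ℝ, E) G} (h : HasInitialVelocity φ v) :
    IsMIntegralCurve (I := 𝓘(ℝ, E)) (fun t : ℝ => φ (Multiplicative.ofAdd t))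
      (mulInvariantVectorField v) := by
  intro t
  set g := φ (Multiplicative.ofAdd t) with hg
  have hs : ContMDiff 𝓘(ℝ, E) 𝓘(ℝ, E) ∞ (fun h : G => g * h) :=
    contMDiff_const.mul contMDiff_id
  have key : ∀ x : G, x = 1 → HasMFDerivAt 𝓘(ℝ, E) 𝓘(ℝ, E) (fun h : G => g * h) x
      (show E →L[ℝ] E from mfderiv 𝓘(ℝ, E) 𝓘(ℝ, E) (fun h : G => g * h) 1) := by
    rintro x rfl
    exact (hs.mdifferentiable (by simp) 1).hasMFDerivAt
  have h2 := HasMFDerivAt.comp (0 : ℝ) (key (φ (Multiplicative.ofAdd 0)) (map_one φ)) h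
  have h3 : HasMFDerivAt 𝓘(ℝ, ℝ) 𝓘(ℝ, ℝ) (fun s : ℝ => s - t) t
      (ContinuousLinearMap.id ℝ ℝ) :=
    ((hasFDerivAt_id t).sub_const t).hasMFDerivAt
  have key' : ∀ s : ℝ, s = 0 → HasMFDerivAt 𝓘(ℝ, ℝ) 𝓘(ℝ, E)
      ((fun h : G => g * h) ∘ fun t : ℝ => φ (Multiplicative.ofAdd t)) s
      ((show E →L[ℝ] E from mfderiv 𝓘(ℝ, E) 𝓘(ℝ, E) (fun h : G => g * h) 1).comp
        (ContinuousLinearMap.toSpanSingleton ℝ (show E from v))) := by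
    rintro s rfl
    exact h2
  have h4 := HasMFDerivAt.comp (f := fun s : ℝ => s - t) t (key' (t - t) (sub_self t)) h3
  have hfun : (((fun h : G => g * h) ∘ fun t : ℝ => φ (Multiplicative.ofAdd t)) ∘ fun s : ℝ => s - t)
      = fun s : ℝ => φ (Multiplicative.ofAdd s) := by
    funext s
    simp only [Function.comp, hg]
    rw [← map_mul, ← ofAdd_add, add_sub_cancel]
  have h5 := h4.congr_of_eventuallyEq (Filter.Eventually.of_forall fun s => (congrFun hfun s).symm)
  refine h5.congr_mfderiv ?_
  ext
  change (show E →L[ℝ] E from mfderiv 𝓘(ℝ, E) 𝓘(ℝ, E) (fun h : G => g * h) 1)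
    ((1 : ℝ) • (show E from v)) = (1 : ℝ) •
      (show E →L[ℝ] E from mfderiv 𝓘(ℝ, E) 𝓘(ℝ, E) (fun h : G => g * h) 1) v
  rw [one_smul, one_smul]

theorem HasInitialVelocity.unique [FiniteDimensional ℝ E] [T2Space G]
    {φ ψ : Multiplicative ℝ →ₜ* G}
    {v : GroupLieAlgebra 𝓘(ℝ, E) G} (hφ : HasInitialVelocity φ v) (hψ : HasInitialVelocity ψ v)
    (t : ℝ) : φ (Multiplicative.ofAdd t) = ψ (Multiplicative.ofAdd t) := by
  have : LieGroup 𝓘(ℝ, E) (minSmoothness ℝ 3) G := by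
    rw [minSmoothness_of_isRCLikeNormedField]
    exact LieGroup.of_le (n := ∞) (by norm_cast)
  have : IsManifold 𝓘(ℝ, E) 1 G := IsManifold.of_le (n := ∞) (by exact_mod_cast le_top)
  have h := isMIntegralCurve_Ioo_eq_of_contMDiff_boundaryless (t₀ := 0)
    ((contMDiff_mulInvariantVectorField v).of_le (by
      rw [minSmoothness_of_isRCLikeNormedField]; norm_num)) hφ.isMIntegralCurve
    hψ.isMIntegralCurve (by rw [ofAdd_zero, map_one, map_one])
  exact congrFun h t

theorem HasInitialVelocity.lieExp_smul [FiniteDimensional ℝ E] [T2Space G]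
    {φ : Multiplicative ℝ →ₜ* G}
    {v : GroupLieAlgebra 𝓘(ℝ, E) G} (hφ : HasInitialVelocity φ v) (t : ℝ) :
    lieExp (t • v) = φ (Multiplicative.ofAdd t) := by
  have hex : ∃ ψ : Multiplicative ℝ →ₜ* G, HasInitialVelocity ψ (t • v) := ⟨_, hφ.rescale t⟩
  rw [lieExp, dif_pos hex, hex.choose_spec.unique (hφ.rescale t), oneParamRescale_apply, mul_one]

/-- A subgroup for `t • v` with `t ≠ 0` would rescale to one for `v`. So the default branch of
`lieExp` is taken consistently along the whole line, and existence of the exponential map need not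
be proved. -/
theorem lieExp_smul_of_not_exists [FiniteDimensional ℝ E] [T2Space G]
    {v : GroupLieAlgebra 𝓘(ℝ, E) G} (hv : ¬ ∃ φ : Multiplicative ℝ →ₜ* G, HasInitialVelocity φ v)
    (t : ℝ) : lieExp (t • v) = 1 := by
  by_cases hex : ∃ ψ : Multiplicative ℝ →ₜ* G, HasInitialVelocity ψ (t • v)
  · obtain ⟨ψ, hψ⟩ := hex
    rcases eq_or_ne t 0 with rfl | ht
    · have h0 := (hasInitialVelocity_one (E := E) (G := G)).lieExp_smul 0
      rw [zero_smul] at h0 ⊢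
      rw [h0]; rfl
    · have h1 := hψ.rescale t⁻¹
      rw [smul_smul, inv_mul_cancel₀ ht, one_smul] at h1
      exact absurd ⟨_, h1⟩ hv
  · rw [lieExp, dif_neg hex]

/-- `t ↦ lieExp (t • v)` is a one-parameter subgroup. -/
theorem exists_oneParam_lieExp [FiniteDimensional ℝ E] [T2Space G]
    (v : GroupLieAlgebra 𝓘(ℝ, E) G) :
    ∃ (φ : Multiplicative ℝ →ₜ* G) (v' : GroupLieAlgebra 𝓘(ℝ, E) G), HasInitialVelocity φ v' ∧
      ∀ t : ℝ, lieExp (t • v) = φ (Multiplicative.ofAdd t) := by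
  by_cases hv : ∃ φ : Multiplicative ℝ →ₜ* G, HasInitialVelocity φ v
  · obtain ⟨φ, hφ⟩ := hv
    exact ⟨φ, v, hφ, hφ.lieExp_smul⟩
  -- In the default branch the subgroup is trivial and its velocity is `0`, not `v`; this is why
  -- `v'` is kept separate.
  · exact ⟨1, 0, hasInitialVelocity_one, lieExp_smul_of_not_exists hv⟩

/-- The eigenvector hypothesis enters here: conjugation by `g` and rescaling by `c` yield subgroups
with the same initial velocity. -/
theorem conj_lieExp_of_lieAd_eq_smul [FiniteDimensional ℝ E] [T2Space G] {g : G}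
    {v : GroupLieAlgebra 𝓘(ℝ, E) G} {c : ℝ} (h : lieAd g v = c • v) (t : ℝ) :
    g * lieExp (t • v) * g⁻¹ = lieExp ((c * t) • v) := by
  by_cases hv : ∃ φ : Multiplicative ℝ →ₜ* G, HasInitialVelocity φ v
  · obtain ⟨φ, hφ⟩ := hv
    have h1 := hφ.conj g
    rw [h] at h1
    have h2 := h1.unique (hφ.rescale c) t
    rw [oneParamConj_apply, oneParamRescale_apply] at h2
    rw [hφ.lieExp_smul, hφ.lieExp_smul, h2]
  · simp [lieExp_smul_of_not_exists hv]

end OneParameter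

/-! ### Derivatives along left-invariant vector fields. -/

section LeftDerivative

variable {E : Type*} [NormedAddCommGroup E] [NormedSpace ℝ E]
  {G : Type*} [TopologicalSpace G] [ChartedSpace E G] [Group G]

/-- The derivative of `θ` along the left-invariant vector field of `v`. -/
noncomputable def leftDeriv (v : GroupLieAlgebra 𝓘(ℝ, E) G) (θ : G → ℝ) (g : G) : ℝ :=
  (show E →L[ℝ] ℝ from mfderiv 𝓘(ℝ, E) 𝓘(ℝ, ℝ) (fun h : G => θ (g * h)) 1) (show E from v)

variable [LieGroup 𝓘(ℝ, E) ∞ G]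

/-- The source base point is fixed and the target is a vector space, so both coordinate changes are
the identity. -/
theorem inTangentCoordinates_const_one (f : G → ℝ) (ϕ : G → E →L[ℝ] ℝ) (g₀ g : G) (v : E) :
    inTangentCoordinates 𝓘(ℝ, E) 𝓘(ℝ, ℝ) (fun _ : G => (1 : G)) f ϕ g₀ g v = ϕ g v := by
  have : IsManifold 𝓘(ℝ, E) 1 G := IsManifold.of_le (n := ∞) (by exact_mod_cast le_top)
  rw [inTangentCoordinates_eq (fun _ : G => (1 : G)) f ϕ (x₀ := g₀) (x := g)
    (mem_chart_source E (1 : G)) (mem_univ _)]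
  change (tangentBundleCore 𝓘(ℝ, ℝ) ℝ).coordChange _ _ _ (ϕ g
    ((tangentBundleCore 𝓘(ℝ, E) G).coordChange (achart E (1 : G)) (achart E (1 : G)) 1 v)) = _
  rw [(tangentBundleCore 𝓘(ℝ, E) G).coordChange_self _ _ (mem_chart_source E (1 : G)),
    tangentBundleCore_coordChange_model_space]
  rfl

/-- Joint smoothness of `(g, h) ↦ θ (g * h)` makes its partial derivative in `h` at `1` smooth in
`g`. -/
theorem contMDiff_leftDeriv (v : GroupLieAlgebra 𝓘(ℝ, E) G) {θ : G → ℝ}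
    (hθ : ContMDiff 𝓘(ℝ, E) 𝓘(ℝ, ℝ) ∞ θ) :
    ContMDiff 𝓘(ℝ, E) 𝓘(ℝ, ℝ) ∞ (leftDeriv v θ) := by
  have : IsManifold 𝓘(ℝ, E) 1 G := IsManifold.of_le (n := ∞) (by exact_mod_cast le_top)
  intro g₀
  have hF : ContMDiffAt (𝓘(ℝ, E).prod 𝓘(ℝ, E)) 𝓘(ℝ, ℝ) ∞
      (Function.uncurry fun g h : G => θ (g * h)) (g₀, 1) :=
    (hθ.comp (contMDiff_mul 𝓘(ℝ, E) ∞)).contMDiffAt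
  have h1 := hF.mfderiv_apply (m := ∞) (fun g h : G => θ (g * h)) (fun _ => (1 : G)) id
    (fun _ => (show E from v)) contMDiffAt_const contMDiffAt_id contMDiffAt_const (by simp)
  refine h1.congr_of_eventuallyEq (Eventually.of_forall fun g => ?_)
  exact (inTangentCoordinates_const_one _
    (fun g => (show E →L[ℝ] ℝ from mfderiv 𝓘(ℝ, E) 𝓘(ℝ, ℝ) (fun h : G => θ (g * h)) 1))
    g₀ g (show E from v)).symm

theorem leftDeriv_eq_zero_of_notMem_tsupport (v : GroupLieAlgebra 𝓘(ℝ, E) G) {θ : G → ℝ} {g : G}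
    (hg : g ∉ tsupport θ) : leftDeriv v θ g = 0 := by
  have := topologicalGroup_of_lieGroup 𝓘(ℝ, E) ∞ (G := G)
  have h0 : (fun h : G => θ (g * h)) =ᶠ[𝓝 1] fun _ => (0 : ℝ) := by
    have hc : Tendsto (fun h : G => g * h) (𝓝 1) (𝓝 g) := by
      have := (continuous_const_mul g).tendsto (1 : G)
      rwa [mul_one] at this
    exact hc.eventually (notMem_tsupport_iff_eventuallyEq.mp hg)
  unfold leftDeriv
  rw [h0.mfderiv_eq, mfderiv_const]
  rfl

theorem hasCompactSupport_leftDeriv (v : GroupLieAlgebra 𝓘(ℝ, E) G) {θ : G → ℝ}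
    (hθ : HasCompactSupport θ) : HasCompactSupport (leftDeriv v θ) := by
  have := topologicalGroup_of_lieGroup 𝓘(ℝ, E) ∞ (G := G)
  refine hθ.mono' fun g hg => ?_
  by_contra h
  exact hg (leftDeriv_eq_zero_of_notMem_tsupport v h)

theorem HasInitialVelocity.hasDerivAt_comp {φ : Multiplicative ℝ →ₜ* G}
    {v : GroupLieAlgebra 𝓘(ℝ, E) G} (h : HasInitialVelocity φ v) {θ : G → ℝ}
    (hθ : ContMDiff 𝓘(ℝ, E) 𝓘(ℝ, ℝ) ∞ θ) (g : G) (t : ℝ) :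
    HasDerivAt (fun s : ℝ => θ (g * φ (Multiplicative.ofAdd s)))
      (leftDeriv v θ (g * φ (Multiplicative.ofAdd t))) t := by
  have zero : ∀ g : G, HasDerivAt (fun s : ℝ => θ (g * φ (Multiplicative.ofAdd s)))
      (leftDeriv v θ g) 0 := by
    intro g
    have hs : ContMDiff 𝓘(ℝ, E) 𝓘(ℝ, ℝ) ∞ (fun h : G => θ (g * h)) :=
      hθ.comp (contMDiff_const.mul contMDiff_id)
    have key : ∀ x : G, x = 1 → HasMFDerivAt 𝓘(ℝ, E) 𝓘(ℝ, ℝ) (fun h : G => θ (g * h)) x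
        (show E →L[ℝ] ℝ from mfderiv 𝓘(ℝ, E) 𝓘(ℝ, ℝ) (fun h : G => θ (g * h)) 1) := by
      rintro x rfl
      exact (hs.mdifferentiable (by simp) 1).hasMFDerivAt
    have h2 := HasMFDerivAt.comp (0 : ℝ) (key (φ (Multiplicative.ofAdd 0)) (map_one φ)) h
    have h3 : HasFDerivAt (fun s : ℝ => θ (g * φ (Multiplicative.ofAdd s)))
        ((show E →L[ℝ] ℝ from mfderiv 𝓘(ℝ, E) 𝓘(ℝ, ℝ) (fun h : G => θ (g * h)) 1).comp
          (ContinuousLinearMap.toSpanSingleton ℝ (show E from v))) 0 :=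
      hasMFDerivAt_iff_hasFDerivAt.mp h2
    refine h3.hasDerivAt.congr_deriv ?_
    change (show E →L[ℝ] ℝ from mfderiv 𝓘(ℝ, E) 𝓘(ℝ, ℝ) (fun h : G => θ (g * h)) 1)
      ((1 : ℝ) • (show E from v)) = _
    rw [one_smul]
    rfl
  have h1 := zero (g * φ (Multiplicative.ofAdd t))
  rw [← sub_self t] at h1
  have h2 := HasDerivAt.comp (h := fun s : ℝ => s - t) t h1 ((hasDerivAt_id t).sub_const t)
  rw [mul_one] at h2
  refine h2.congr_of_eventuallyEq (Eventually.of_forall fun s => ?_)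
  simp only [Function.comp]
  rw [mul_assoc, ← map_mul, ← ofAdd_add, add_sub_cancel]

end LeftDerivative

/-! ### The Riemannian distance and left translations of the quotient. -/

section Metric

variable {E : Type*} [NormedAddCommGroup E] [NormedSpace ℝ E]
  {G : Type*} [TopologicalSpace G] [ChartedSpace E G] [Group G] [LieGroup 𝓘(ℝ, E) ∞ G]

theorem eventually_lieDist_lt (gm : LieRiemannianMetric E G) (x : G) {c : ℝ≥0∞} (hc : 0 < c) :
    ∀ᶠ y in 𝓝 x, lieDist gm x y < c := by
  let _ : RiemannianBundle (fun g : G => TangentSpace 𝓘(ℝ, E) g) := ⟨gm.toRiemannianMetric⟩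
  have : IsManifold 𝓘(ℝ, E) 1 G := IsManifold.of_le (n := ∞) (by exact_mod_cast le_top)
  have : IsContinuousRiemannianBundle E (fun g : G => TangentSpace 𝓘(ℝ, E) g) :=
    ⟨gm.inner, gm.contMDiff.continuous, fun _ _ _ => rfl⟩
  exact eventually_riemannianEDist_lt 𝓘(ℝ, E) x hc

theorem lieDist_mul_right_le {gm : LieRiemannianMetric E G} (hgm : IsRightInvariantMetric gm)
    (x y h : G) : lieDist gm (x * h) (y * h) ≤ lieDist gm x y := by
  let _ : RiemannianBundle (fun g : G => TangentSpace 𝓘(ℝ, E) g) := ⟨gm.toRiemannianMetric⟩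
  have : IsManifold 𝓘(ℝ, E) 1 G := IsManifold.of_le (n := ∞) (by exact_mod_cast le_top)
  change Manifold.riemannianEDist 𝓘(ℝ, E) (x * h) (y * h) ≤ Manifold.riemannianEDist 𝓘(ℝ, E) x y
  refine le_of_forall_gt fun r hr => ?_
  obtain ⟨c, hc0, hc1, hcs, hc, -, -⟩ :=
    Manifold.exists_lt_locally_constant_of_riemannianEDist_lt hr zero_lt_one
  have hs : ContMDiff 𝓘(ℝ, E) 𝓘(ℝ, E) ∞ (fun y : G => y * h) := contMDiff_id.mul contMDiff_const
  refine lt_of_le_of_lt ?_ hc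
  refine (Manifold.riemannianEDist_le_pathELength (γ := fun t : ℝ => c t * h)
    ((hs.of_le (by norm_cast)).comp hcs).contMDiffOn (by rw [hc0]) (by rw [hc1])
    zero_le_one).trans_eq ?_
  rw [Manifold.pathELength_eq_lintegral_mfderiv_Icc, Manifold.pathELength_eq_lintegral_mfderiv_Icc]
  refine lintegral_congr fun t => ?_
  have hd : mfderiv 𝓘(ℝ, ℝ) 𝓘(ℝ, E) (fun t : ℝ => c t * h) t =
      (mfderiv 𝓘(ℝ, E) 𝓘(ℝ, E) (fun y : G => y * h) (c t)).comp (mfderiv 𝓘(ℝ, ℝ) 𝓘(ℝ, E) c t) :=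
    mfderiv_comp (I' := 𝓘(ℝ, E)) t (hs.mdifferentiable (by simp) _)
      (hcs.mdifferentiable one_ne_zero t)
  rw [hd]
  have hn : ∀ (g : G) (v : TangentSpace 𝓘(ℝ, E) g), ‖v‖ = √(gm.inner g v v) := fun g v =>
    norm_eq_sqrt_real_inner v
  have key : ∀ v : TangentSpace 𝓘(ℝ, E) (c t),
      ‖mfderiv 𝓘(ℝ, E) 𝓘(ℝ, E) (fun y : G => y * h) (c t) v‖ = ‖v‖ := fun v => by
    rw [hn, hn, hgm]
  exact (ofReal_norm _).symm.trans ((congrArg ENNReal.ofReal (key _)).trans (ofReal_norm _))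

/-- The representatives `h` and `g * h` differ by a right translation from `1` and `g`, which makes
the bound uniform in `x`. -/
theorem quotientDist_smul_le {gm : LieRiemannianMetric E G} (hgm : IsRightInvariantMetric gm)
    (Γ : Subgroup G) (g : G) (x : G ⧸ Γ) :
    quotientDist gm Γ x (g • x) ≤ lieDist gm 1 g := by
  induction x using QuotientGroup.induction_on with
  | H h =>
    refine (iInf_le_of_le h <| iInf_le_of_le (g * h) <| iInf_le_of_le rfl <|
      iInf_le_of_le rfl le_rfl).trans ?_
    have := lieDist_mul_right_le hgm 1 g h
    rwa [one_mul] at this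

/-- A uniformly continuous function varies little under elements close to the identity. -/
theorem UnifContWrt.eventually_abs_sub_lt {gm : LieRiemannianMetric E G}
    (hgm : IsRightInvariantMetric gm) {Γ : Subgroup G} {D : G ⧸ Γ → ℝ}
    (hD : UnifContWrt (quotientDist gm Γ) D) {ε : ℝ} (hε : 0 < ε) :
    ∀ᶠ g in 𝓝 (1 : G), ∀ x, |D x - D (g • x)| < ε := by
  obtain ⟨η, hη, h⟩ := hD ε hε
  filter_upwards [eventually_lieDist_lt gm 1 hη] with g hg x
  exact h _ _ ((quotientDist_smul_le hgm Γ g x).trans_lt hg)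

end Metric

/-! ### Calculus of functions with bounded iterated derivatives. -/

section DerivBound

variable {E : Type*} [NormedAddCommGroup E] [NormedSpace ℝ E]
  {G : Type*} [TopologicalSpace G] [ChartedSpace E G] [Group G]
  {X : Type*} [MulAction G X]
  {d : ℕ} {ζ : Module.Basis (Fin d) ℝ (GroupLieAlgebra 𝓘(ℝ, E) G)}

theorem HasLieDerivative.add {v : GroupLieAlgebra 𝓘(ℝ, E) G} {f g : X → ℝ}
    (hf : HasLieDerivative v f) (hg : HasLieDerivative v g) :
    HasLieDerivative v (fun x => f x + g x) := fun x => (hf x).add (hg x)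

theorem HasLieDerivative.mul {v : GroupLieAlgebra 𝓘(ℝ, E) G} {f g : X → ℝ}
    (hf : HasLieDerivative v f) (hg : HasLieDerivative v g) :
    HasLieDerivative v (fun x => f x * g x) := fun x => (hf x).mul (hg x)

theorem HasLieDerivative.const_mul {v : GroupLieAlgebra 𝓘(ℝ, E) G} {f : X → ℝ}
    (hf : HasLieDerivative v f) (c : ℝ) :
    HasLieDerivative v (fun x => c * f x) := fun x => (hf x).const_mul c

theorem lieDerivative_add {v : GroupLieAlgebra 𝓘(ℝ, E) G} {f g : X → ℝ}
    (hf : HasLieDerivative v f) (hg : HasLieDerivative v g) :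
    lieDerivative v (fun x => f x + g x) = fun x => lieDerivative v f x + lieDerivative v g x :=
  funext fun x => ((hf x).hasDerivAt.add (hg x).hasDerivAt).deriv

theorem lieDerivative_const_mul {v : GroupLieAlgebra 𝓘(ℝ, E) G} {f : X → ℝ}
    (hf : HasLieDerivative v f) (c : ℝ) :
    lieDerivative v (fun x => c * f x) = fun x => c * lieDerivative v f x :=
  funext fun x => ((hf x).hasDerivAt.const_mul c).deriv

theorem lieDerivative_const (v : GroupLieAlgebra 𝓘(ℝ, E) G) (c : ℝ) :
    lieDerivative v (fun _ : X => c) = fun _ => 0 :=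
  funext fun _ => deriv_const _ _

theorem lieDerivative_mul {v : GroupLieAlgebra 𝓘(ℝ, E) G} (h0 : lieExp ((0 : ℝ) • v) = 1)
    {f g : X → ℝ} (hf : HasLieDerivative v f) (hg : HasLieDerivative v g) :
    lieDerivative v (fun x => f x * g x) =
      fun x => lieDerivative v f x * g x + f x * lieDerivative v g x := by
  funext x
  have h := ((hf x).hasDerivAt.mul (hg x).hasDerivAt).deriv
  rw [h0, one_smul] at h
  exact h

/-- `iterLieDerivative` unfolds from the outermost derivative, `DerivBound` from the innermost one;
this reconciles the two recursions. -/
theorem iterLieDerivative_append_singleton (w : List (Fin d)) (i : Fin d) (f : X → ℝ) :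
    iterLieDerivative ζ (w ++ [i]) f = iterLieDerivative ζ w (lieDerivative (ζ i) f) := by
  induction w with
  | nil => rfl
  | cons j w ih => exact congrArg (lieDerivative (ζ j)) ih

variable [MeasurableSpace X] (ζ)

/-- The iterated derivatives of order `j ≤ k` of `f` exist, are measurable, and are bounded by
`A ^ j * M`. -/
def DerivBound : ℕ → ℝ → ℝ → (X → ℝ) → Prop
  | 0, M, _, f => Measurable f ∧ ∀ x, |f x| ≤ M
  | k + 1, M, A, f => (Measurable f ∧ ∀ x, |f x| ≤ M) ∧
      ∀ i, HasLieDerivative (ζ i) f ∧ DerivBound k (A * M) A (lieDerivative (ζ i) f)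

variable {ζ}

namespace DerivBound

variable {k : ℕ} {M M' A A' : ℝ} {f g : X → ℝ}

theorem measurable (h : DerivBound ζ k M A f) : Measurable f := by
  cases k with
  | zero => exact h.1
  | succ k => exact h.1.1

theorem abs_le (h : DerivBound ζ k M A f) (x : X) : |f x| ≤ M := by
  cases k with
  | zero => exact h.2 x
  | succ k => exact h.1.2 x

theorem mono (h : DerivBound ζ k M A f) (hM0 : 0 ≤ M) (hM : M ≤ M') (hA0 : 0 ≤ A) (hA : A ≤ A') :
    DerivBound ζ k M' A' f := by
  induction k generalizing f M M' with
  | zero => exact ⟨h.1, fun x => (h.2 x).trans hM⟩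
  | succ k ih =>
    exact ⟨⟨h.1.1, fun x => (h.1.2 x).trans hM⟩, fun i => ⟨(h.2 i).1,
      ih (h.2 i).2 (mul_nonneg hA0 hM0) (mul_le_mul hA hM hM0 (hA0.trans hA))⟩⟩

theorem mono_order {k' : ℕ} (h : DerivBound ζ k M A f) (hk : k' ≤ k) : DerivBound ζ k' M A f := by
  induction k' generalizing f M k with
  | zero => exact ⟨h.measurable, h.abs_le⟩
  | succ k' ih =>
    obtain ⟨k, rfl⟩ : ∃ j, k = j + 1 := ⟨k - 1, by omega⟩
    exact ⟨h.1, fun i => ⟨(h.2 i).1, ih (h.2 i).2 (by omega)⟩⟩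

theorem const {c : ℝ} (hc : |c| ≤ M) (hA : 0 ≤ A) : DerivBound ζ k M A (fun _ : X => c) := by
  induction k generalizing c M with
  | zero => exact ⟨measurable_const, fun _ => hc⟩
  | succ k ih =>
    refine ⟨⟨measurable_const, fun _ => hc⟩, fun i => ⟨fun x => differentiableAt_const _, ?_⟩⟩
    rw [lieDerivative_const]
    exact ih (by rw [abs_zero]; exact mul_nonneg hA ((abs_nonneg c).trans hc))

theorem const_mul (h : DerivBound ζ k M A f) (c : ℝ) :
    DerivBound ζ k (|c| * M) A (fun x => c * f x) := by
  have hb : ∀ {M : ℝ} {f : X → ℝ}, (∀ x, |f x| ≤ M) → ∀ x, |c * f x| ≤ |c| * M := fun h x => by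
    rw [abs_mul]
    exact mul_le_mul_of_nonneg_left (h x) (abs_nonneg c)
  induction k generalizing f M with
  | zero => exact ⟨h.1.const_mul c, hb h.2⟩
  | succ k ih =>
    refine ⟨⟨h.1.1.const_mul c, hb h.1.2⟩, fun i => ⟨(h.2 i).1.const_mul c, ?_⟩⟩
    rw [lieDerivative_const_mul (h.2 i).1, mul_left_comm]
    exact ih (h.2 i).2

theorem add (hf : DerivBound ζ k M A f) (hg : DerivBound ζ k M' A g) :
    DerivBound ζ k (M + M') A (fun x => f x + g x) := by
  induction k generalizing f g M M' with
  | zero => exact ⟨hf.1.add hg.1, fun x => (abs_add_le _ _).trans (add_le_add (hf.2 x) (hg.2 x))⟩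
  | succ k ih =>
    refine ⟨⟨hf.1.1.add hg.1.1, fun x =>
      (abs_add_le _ _).trans (add_le_add (hf.1.2 x) (hg.1.2 x))⟩,
      fun i => ⟨(hf.2 i).1.add (hg.2 i).1, ?_⟩⟩
    rw [lieDerivative_add (hf.2 i).1 (hg.2 i).1, mul_add]
    exact ih (hf.2 i).2 (hg.2 i).2

theorem sub (hf : DerivBound ζ k M A f) (hg : DerivBound ζ k M' A g) :
    DerivBound ζ k (M + M') A (fun x => f x - g x) := by
  have h := hf.add (hg.const_mul (-1))
  rw [abs_neg, abs_one, one_mul] at h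
  refine (congrArg (DerivBound ζ k (M + M') A) (funext fun x => ?_)).mp h
  ring

end DerivBound

/-- Each order of the Leibniz rule doubles the number of terms, hence `2 ^ k`. The scale `A` is
unchanged, so a product of `n` factors costs `A ^ k` and not `A ^ (n * k)`. -/
theorem DerivBound.mul (h0 : ∀ i, lieExp ((0 : ℝ) • ζ i) = 1) {k : ℕ} {M M' A : ℝ} (hM : 0 ≤ M)
    (hM' : 0 ≤ M') (hA : 0 ≤ A) {f g : X → ℝ}
    (hf : DerivBound ζ k M A f) (hg : DerivBound ζ k M' A g) :
    DerivBound ζ k (2 ^ k * (M * M')) A (fun x => f x * g x) := by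
  have hb : ∀ {M M' : ℝ} {f g : X → ℝ}, 0 ≤ M → (∀ x, |f x| ≤ M) → (∀ x, |g x| ≤ M') →
      ∀ x, |f x * g x| ≤ M * M' := fun h0 h h' x => by
    rw [abs_mul]
    exact mul_le_mul (h x) (h' x) (abs_nonneg _) h0
  induction k generalizing f g M M' with
  | zero => exact ⟨hf.1.mul hg.1, by rw [pow_zero, one_mul]; exact hb hM hf.2 hg.2⟩
  | succ k ih =>
    refine ⟨⟨hf.1.1.mul hg.1.1, fun x => (hb hM hf.1.2 hg.1.2 x).trans
      (le_mul_of_one_le_left (mul_nonneg hM hM') (one_le_pow₀ one_le_two))⟩,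
      fun i => ⟨(hf.2 i).1.mul (hg.2 i).1, ?_⟩⟩
    rw [lieDerivative_mul (h0 i) (hf.2 i).1 (hg.2 i).1]
    have h1 := ih (mul_nonneg hA hM) hM' (hf.2 i).2 (hg.mono_order k.le_succ)
    have h2 := ih hM (mul_nonneg hA hM') (hf.mono_order k.le_succ) (hg.2 i).2
    have h3 := h1.add h2
    rwa [show 2 ^ k * (A * M * M') + 2 ^ k * (M * (A * M')) = A * (2 ^ (k + 1) * (M * M')) by
      ring] at h3

/-- The conjugation relation gives `D_ζ (f ∘ h) = c * (D_ζ f) ∘ h`, so each derivative costs one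
factor `C`. -/
theorem DerivBound.comp_smul [MeasurableConstSMul G X] {h : G} {c : Fin d → ℝ} {C : ℝ}
    (hconj : ∀ i (t : ℝ), h * lieExp (t • ζ i) * h⁻¹ = lieExp ((c i * t) • ζ i))
    (hc : ∀ i, |c i| ≤ C) (hC : 0 ≤ C) {k : ℕ} {M A : ℝ} (hM : 0 ≤ M) (hA : 0 ≤ A) {f : X → ℝ}
    (hf : DerivBound ζ k M A f) : DerivBound ζ k M (C * A) (fun x => f (h • x)) := by
  induction k generalizing f M with
  | zero => exact ⟨hf.1.comp (measurable_const_smul h), fun x => hf.2 _⟩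
  | succ k ih =>
    refine ⟨⟨hf.1.1.comp (measurable_const_smul h), fun x => hf.1.2 _⟩, fun i => ?_⟩
    have hd : ∀ x, HasDerivAt (fun t : ℝ => f (h • lieExp (t • ζ i) • x))
        (c i * lieDerivative (ζ i) f (h • x)) 0 := by
      intro x
      have h1 := ((hf.2 i).1 (h • x)).hasDerivAt
      rw [← mul_zero (c i)] at h1
      have h2 := HasDerivAt.comp (h := fun t : ℝ => c i * t) 0 h1
        ((hasDerivAt_id (0 : ℝ)).const_mul (c i))
      rw [mul_one, mul_zero, mul_comm] at h2
      refine h2.congr_of_eventuallyEq (Eventually.of_forall fun t => ?_)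
      change f (h • lieExp (t • ζ i) • x) = f (lieExp ((c i * t) • ζ i) • h • x)
      rw [← hconj, ← mul_smul, ← mul_smul, inv_mul_cancel_right]
    refine ⟨fun x => (hd x).differentiableAt, ?_⟩
    rw [show lieDerivative (ζ i) (fun x => f (h • x)) =
      fun x => c i * lieDerivative (ζ i) f (h • x) from funext fun x => (hd x).deriv]
    refine ((ih (mul_nonneg hA hM) (hf.2 i).2).const_mul (c i)).mono
      (mul_nonneg (abs_nonneg _) (mul_nonneg hA hM)) ?_ (mul_nonneg hC hA) le_rfl
    rw [mul_assoc]
    exact mul_le_mul_of_nonneg_right (hc i) (mul_nonneg hA hM)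

theorem DerivBound.iterLieDerivative {k : ℕ} {M A : ℝ} {f : X → ℝ} (hf : DerivBound ζ k M A f)
    (w : List (Fin d)) (hw : w.length ≤ k) :
    DerivBound ζ (k - w.length) (A ^ w.length * M) A (iterLieDerivative ζ w f) := by
  induction k generalizing f M w with
  | zero =>
    obtain rfl : w = [] := List.length_eq_zero_iff.mp (by omega)
    simpa [_root_.iterLieDerivative] using hf
  | succ k ih =>
    rcases List.eq_nil_or_concat w with rfl | ⟨w, i, rfl⟩
    · simpa [_root_.iterLieDerivative] using hf
    · rw [List.concat_eq_append, List.length_append, List.length_singleton] at *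
      rw [iterLieDerivative_append_singleton, Nat.add_sub_add_right, pow_succ, mul_assoc]
      exact ih (hf.2 i).2 w (by omega)

theorem DerivBound.memSobolev {μ : Measure X} [IsFiniteMeasure μ] {k : ℕ} {M A : ℝ} {f : X → ℝ}
    (hf : DerivBound ζ k M A f) : MemSobolev ζ μ k f := by
  refine ⟨fun w hw i => ?_, fun w hw => ?_⟩
  · have h := hf.iterLieDerivative w hw.le
    obtain ⟨j, hj⟩ : ∃ j, k - w.length = j + 1 := ⟨k - w.length - 1, by omega⟩
    rw [hj] at h
    exact (h.2 i).1
  · have h := hf.iterLieDerivative w hw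
    exact MemLp.of_bound h.measurable.aestronglyMeasurable _ (Eventually.of_forall h.abs_le)

/-- The square root counts the words of length at most `k`; `1 ≤ A` lets the top order bound all of
them. -/
theorem DerivBound.sobolevNorm_le {μ : Measure X} [IsProbabilityMeasure μ] {k : ℕ} {M A : ℝ}
    (hM : 0 ≤ M) (hA : 1 ≤ A) {f : X → ℝ} (hf : DerivBound ζ k M A f) :
    sobolevNorm ζ μ k f ≤ √(∑ l ∈ Finset.range (k + 1), (d : ℝ) ^ l) * (A ^ k * M) := by
  have h0 : 0 ≤ A ^ k * M := mul_nonneg (pow_nonneg (zero_le_one.trans hA) k) hM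
  refine (Real.sqrt_le_sqrt (y := (∑ l ∈ Finset.range (k + 1), (d : ℝ) ^ l) *
    (A ^ k * M) ^ 2) ?_).trans_eq (by
    rw [Real.sqrt_mul (Finset.sum_nonneg fun l _ => by positivity) ((A ^ k * M) ^ 2),
      Real.sqrt_sq h0])
  rw [Finset.sum_mul]
  refine Finset.sum_le_sum fun l hl => ?_
  have hl : l ≤ k := Nat.lt_succ_iff.mp (Finset.mem_range.mp hl)
  have hn : ∀ n : Fin l → Fin d, ∫ x, (_root_.iterLieDerivative ζ (List.ofFn n) f x) ^ 2 ∂μ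
      ≤ (A ^ k * M) ^ 2 := by
    intro n
    have h := hf.iterLieDerivative (List.ofFn n) (by rw [List.length_ofFn]; exact hl)
    rw [List.length_ofFn] at h
    have hb : ∀ x, (_root_.iterLieDerivative ζ (List.ofFn n) f x) ^ 2 ≤ (A ^ k * M) ^ 2 := by
      intro x
      rw [← sq_abs]
      exact pow_le_pow_left₀ (abs_nonneg _) ((h.abs_le x).trans
        (mul_le_mul_of_nonneg_right (pow_le_pow_right₀ hA hl) hM)) 2
    have h2 := integral_mono_of_nonneg (μ := μ) (Eventually.of_forall fun x => sq_nonneg _)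
      (integrable_const ((A ^ k * M) ^ 2)) (Eventually.of_forall hb)
    simpa using h2
  refine (Finset.sum_le_card_nsmul _ _ _ fun n _ => hn n).trans_eq ?_
  simp

end DerivBound

/-! ### Smoothing a bounded function by averaging over `G`. -/

section Smoothing

variable {G : Type*} [TopologicalSpace G] [Group G] [IsTopologicalGroup G]
  [MeasurableSpace G] [BorelSpace G]
  (ν : Measure G) [ν.IsHaarMeasure]
  {X : Type*} [MulAction G X]

/-- The average of `F` over translates with weight `θ`. -/
noncomputable def smoothing (θ : G → ℝ) (F : X → ℝ) (x : X) : ℝ :=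
  ∫ g, θ g⁻¹ * F (g⁻¹ • x) ∂ν

variable {ν}

theorem integrable_comp_inv_of_hasCompactSupport {θ : G → ℝ} (hc : Continuous θ)
    (hs : HasCompactSupport θ) : Integrable (fun g => θ g⁻¹) ν :=
  (hc.comp continuous_inv).integrable_of_hasCompactSupport
    (hs.comp_homeomorph (Homeomorph.inv G))

theorem abs_smoothing_le {θ : G → ℝ} (hc : Continuous θ) (hs : HasCompactSupport θ)
    {F : X → ℝ} (hF1 : ∀ x, |F x| ≤ 1) (x : X) :
    |smoothing ν θ F x| ≤ ∫ g, |θ g⁻¹| ∂ν := by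
  refine (norm_integral_le_integral_norm (μ := ν) (fun g => θ g⁻¹ * F (g⁻¹ • x))).trans ?_
  refine integral_mono_of_nonneg (Eventually.of_forall fun _ => norm_nonneg _)
    (integrable_comp_inv_of_hasCompactSupport hc hs).abs (Eventually.of_forall fun g => ?_)
  change |θ g⁻¹ * F (g⁻¹ • x)| ≤ |θ g⁻¹|
  rw [abs_mul]
  exact mul_le_of_le_one_right (abs_nonneg _) (hF1 _)

/-- Left invariance of Haar measure moves `h` from `F` to the kernel. Derivatives thus fall on `θ`,
and `F` may be merely bounded and measurable. -/
theorem smoothing_smul (θ : G → ℝ) (F : X → ℝ) (h : G) (x : X) :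
    smoothing ν θ F (h • x) = ∫ g, θ (g⁻¹ * h⁻¹) * F (g⁻¹ • x) ∂ν := by
  unfold smoothing
  rw [← integral_mul_left_eq_self _ h]
  refine integral_congr_ae (Eventually.of_forall fun g => ?_)
  simp only [mul_inv_rev, ← mul_smul, inv_mul_cancel_right]

variable [TopologicalSpace X] [ContinuousSMul G X] [MeasurableSpace X] [BorelSpace X]

theorem measurable_comp_inv_smul {F : X → ℝ} (hF : Measurable F) (x : X) :
    Measurable fun g : G => F (g⁻¹ • x) :=
  hF.comp (continuous_inv.smul continuous_const).measurable

theorem integrable_smoothing {θ : G → ℝ} (hc : Continuous θ) (hs : HasCompactSupport θ)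
    {F : X → ℝ} (hF : Measurable F) (hF1 : ∀ x, |F x| ≤ 1) (x : X) :
    Integrable (fun g => θ g⁻¹ * F (g⁻¹ • x)) ν :=
  (integrable_comp_inv_of_hasCompactSupport hc hs).mul_bdd (c := 1)
    (measurable_comp_inv_smul hF x).aestronglyMeasurable (Eventually.of_forall fun _ => hF1 _)

theorem measurable_smoothing [SecondCountableTopology G] [LocallyCompactSpace G] {θ : G → ℝ}
    (hc : Continuous θ) {F : X → ℝ} (hF : Measurable F) : Measurable (smoothing ν θ F) := by
  have h : Measurable fun p : X × G => θ p.2⁻¹ * F (p.2⁻¹ • p.1) :=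
    (hc.comp continuous_snd.inv).measurable.mul (hF.comp
      (continuous_snd.inv.smul continuous_fst).measurable)
  exact (h.stronglyMeasurable.integral_prod_right' (ν := ν)).measurable

variable [T2Space G] {E : Type*} [NormedAddCommGroup E] [NormedSpace ℝ E]
  [ChartedSpace E G] [LieGroup 𝓘(ℝ, E) ∞ G]

theorem HasInitialVelocity.hasDerivAt_smoothing {φ : Multiplicative ℝ →ₜ* G}
    {v : GroupLieAlgebra 𝓘(ℝ, E) G} (h : HasInitialVelocity φ v) {θ : G → ℝ}
    (hθ : ContMDiff 𝓘(ℝ, E) 𝓘(ℝ, ℝ) ∞ θ) (hs : HasCompactSupport θ)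
    {F : X → ℝ} (hF : Measurable F) (hF1 : ∀ x, |F x| ≤ 1) (x : X) :
    HasDerivAt (fun t : ℝ => smoothing ν θ F (φ (Multiplicative.ofAdd t) • x))
      (smoothing ν (fun g => -leftDeriv v θ g) F x) 0 := by
  have hinv : ∀ t : ℝ, (φ (Multiplicative.ofAdd t))⁻¹ = φ (Multiplicative.ofAdd (-t)) := fun t => by
    rw [← map_inv, ofAdd_neg]
  simp_rw [smoothing_smul, hinv]
  have hLc : Continuous (leftDeriv v θ) := (contMDiff_leftDeriv v hθ).continuous
  have hLs : HasCompactSupport (leftDeriv v θ) := hasCompactSupport_leftDeriv v hs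
  obtain ⟨C, hC⟩ := hLs.exists_bound_of_continuous hLc
  have hφc : Continuous fun t : ℝ => φ (Multiplicative.ofAdd (-t)) :=
    φ.continuous_toFun.comp (continuous_ofAdd.comp continuous_neg)
  -- For all `|t| ≤ 1` the differentiated kernel vanishes unless `g` lies in this compact set, so a
  -- constant on `K` dominates.
  set K : Set G := (fun p : ℝ × G => φ (Multiplicative.ofAdd (-p.1)) * p.2⁻¹) ''
    (Icc (-1) 1 ×ˢ tsupport (leftDeriv v θ)) with hK
  have hKc : IsCompact K := (isCompact_Icc.prod hLs).image
    ((hφc.comp continuous_fst).mul continuous_snd.inv)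
  have hderiv : ∀ (t : ℝ) (g : G), HasDerivAt
      (fun t : ℝ => θ (g⁻¹ * φ (Multiplicative.ofAdd (-t))) * F (g⁻¹ • x))
      (-leftDeriv v θ (g⁻¹ * φ (Multiplicative.ofAdd (-t))) * F (g⁻¹ • x)) t := by
    intro t g
    have h1 := HasDerivAt.comp (h := fun t : ℝ => -t) t (h.hasDerivAt_comp hθ g⁻¹ (-t))
      (hasDerivAt_neg t)
    rw [mul_neg_one] at h1
    exact h1.mul_const _
  have hmeas : ∀ {ψ : G → ℝ}, Continuous ψ → ∀ t : ℝ, AEStronglyMeasurable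
      (fun g => ψ (g⁻¹ * φ (Multiplicative.ofAdd (-t))) * F (g⁻¹ • x)) ν := fun hψ t =>
    ((hψ.comp (continuous_inv.mul continuous_const)).measurable.mul
      (measurable_comp_inv_smul hF x)).aestronglyMeasurable
  have key := (hasDerivAt_integral_of_dominated_loc_of_deriv_le (μ := ν) (x₀ := (0 : ℝ))
    (F := fun t g => θ (g⁻¹ * φ (Multiplicative.ofAdd (-t))) * F (g⁻¹ • x))
    (F' := fun t g => -leftDeriv v θ (g⁻¹ * φ (Multiplicative.ofAdd (-t))) * F (g⁻¹ • x))
    (bound := K.indicator fun _ => C) (s := Icc (-1) 1) (Icc_mem_nhds (by norm_num) (by norm_num))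
    (Eventually.of_forall fun t => hmeas hθ.continuous t) ?_ (hmeas hLc.neg 0) ?_
    ?_ (Eventually.of_forall fun g t _ => hderiv t g)).2
  · refine key.congr_deriv ?_
    simp [smoothing]
  · simpa using integrable_smoothing hθ.continuous hs hF hF1 x
  · refine Eventually.of_forall fun g t ht => ?_
    rw [norm_mul, norm_neg]
    refine (mul_le_of_le_one_right (norm_nonneg _) (hF1 _)).trans ?_
    by_cases hg : g ∈ K
    · rw [indicator_of_mem hg]
      exact hC _
    · rw [indicator_of_notMem hg]
      by_contra hne
      refine hg ⟨(t, g⁻¹ * φ (Multiplicative.ofAdd (-t))), ⟨ht, subset_tsupport _ ?_⟩, ?_⟩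
      · intro h0
        exact hne (by rw [h0, norm_zero])
      · simp
  · exact (integrable_indicator_iff hKc.measurableSet).mpr
      (integrableOn_const hKc.measure_lt_top.ne)

/-- A derivative of a smoothing is the smoothing of the same `F` with kernel `-leftDeriv v θ`, so
the induction runs over all kernels and `M` does not depend on `F`. -/
theorem exists_derivBound_smoothing [SecondCountableTopology G] [LocallyCompactSpace G]
    [FiniteDimensional ℝ E] {d : ℕ}
    (ζ : Module.Basis (Fin d) ℝ (GroupLieAlgebra 𝓘(ℝ, E) G))
    (k : ℕ) {θ : G → ℝ} (hθ : ContMDiff 𝓘(ℝ, E) 𝓘(ℝ, ℝ) ∞ θ) (hs : HasCompactSupport θ) :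
    ∃ M : ℝ, 0 ≤ M ∧ ∀ F : X → ℝ, Measurable F → (∀ x, |F x| ≤ 1) →
      DerivBound ζ k M 1 (smoothing ν θ F) := by
  have h0 : (0 : ℝ) ≤ ∫ g, |θ g⁻¹| ∂ν := integral_nonneg fun _ => abs_nonneg _
  induction k generalizing θ with
  | zero =>
    exact ⟨_, h0, fun F hF hF1 => ⟨measurable_smoothing hθ.continuous hF,
      abs_smoothing_le hθ.continuous hs hF1⟩⟩
  | succ k ih =>
    choose φ v hv hφ using fun i => exists_oneParam_lieExp (ζ i)
    choose M hM0 hM using fun i => ih (θ := fun g => -leftDeriv (v i) θ g)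
      (contMDiff_leftDeriv (v i) hθ).neg (hasCompactSupport_leftDeriv (v i) hs).neg
      (integral_nonneg fun _ => abs_nonneg _)
    have hS : ∀ i, M i ≤ ∑ j, M j := fun i =>
      Finset.single_le_sum (f := M) (fun j _ => hM0 j) (Finset.mem_univ i)
    have hS0 : 0 ≤ ∑ j, M j := Finset.sum_nonneg fun j _ => hM0 j
    refine ⟨(∫ g, |θ g⁻¹| ∂ν) + ∑ i, M i, add_nonneg h0 hS0, fun F hF hF1 =>
      ⟨⟨measurable_smoothing hθ.continuous hF, fun x =>
        (abs_smoothing_le hθ.continuous hs hF1 x).trans (le_add_of_nonneg_right hS0)⟩, fun i => ?_⟩⟩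
    have hd : ∀ x, HasDerivAt (fun t : ℝ => smoothing ν θ F (lieExp (t • ζ i) • x))
        (smoothing ν (fun g => -leftDeriv (v i) θ g) F x) 0 := fun x => by
      simp_rw [hφ i]
      exact (hv i).hasDerivAt_smoothing hθ hs hF hF1 x
    refine ⟨fun x => (hd x).differentiableAt, ?_⟩
    rw [show lieDerivative (ζ i) (smoothing ν θ F) =
      smoothing ν (fun g => -leftDeriv (v i) θ g) F from funext fun x => (hd x).deriv, one_mul]
    exact (hM i F hF hF1).mono (hM0 i) ((hS i).trans (le_add_of_nonneg_left h0)) zero_le_one le_rfl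

end Smoothing

/-! ### Smooth approximation of level sets. -/

section Approximation

variable {E : Type*} [NormedAddCommGroup E] [NormedSpace ℝ E] [FiniteDimensional ℝ E]
  {G : Type*} [TopologicalSpace G] [T2Space G] [SecondCountableTopology G]
  [ChartedSpace E G] [Group G] [LieGroup 𝓘(ℝ, E) ∞ G]

/-- The level sets of a uniformly continuous function are separated by smooth functions whose
derivatives are bounded independently of the level. -/
theorem UnifContWrt.exists_derivBound_between {gm : LieRiemannianMetric E G}
    (hgm : IsRightInvariantMetric gm) {Γ : Subgroup G} [MeasurableSpace (G ⧸ Γ)]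
    [BorelSpace (G ⧸ Γ)] {d : ℕ} (ζ : Module.Basis (Fin d) ℝ (GroupLieAlgebra 𝓘(ℝ, E) G)) (k : ℕ)
    {D : G ⧸ Γ → ℝ} (hDm : Measurable D) (hD : UnifContWrt (quotientDist gm Γ) D)
    {η : ℝ} (hη : 0 < η) :
    ∃ M : ℝ, 0 ≤ M ∧ ∀ u : ℝ, ∃ f : G ⧸ Γ → ℝ, DerivBound ζ k M 1 f ∧ (∀ x, 0 ≤ f x ∧ f x ≤ 1) ∧
      (∀ x, u + η ≤ D x → f x = 1) ∧ ∀ x, D x ≤ u - η → f x = 0 := by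
  have := topologicalGroup_of_lieGroup 𝓘(ℝ, E) ∞ (G := G)
  have : LocallyCompactSpace G := Manifold.locallyCompact_of_finiteDimensional 𝓘(ℝ, E)
  borelize G
  let ν : Measure G := Measure.haar
  obtain ⟨b, -, hb⟩ := (SmoothBumpFunction.nhds_basis_tsupport (I := 𝓘(ℝ, E)) (1 : G)).mem_iff.mp
    (hD.eventually_abs_sub_lt hgm hη)
  have hbi : Integrable (fun g : G => b g⁻¹) ν :=
    integrable_comp_inv_of_hasCompactSupport b.continuous b.hasCompactSupport
  set c : ℝ := ∫ g, b g⁻¹ ∂ν with hc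
  have hcpos : 0 < c := by
    refine (b.continuous.comp continuous_inv).integral_pos_of_hasCompactSupport_nonneg_nonzero
      (x := 1) (b.hasCompactSupport.comp_homeomorph (Homeomorph.inv G)) (fun _ => b.nonneg) ?_
    simp
  -- Normalised so that smoothing is an average over translates that change `D` by less than `η`.
  set θ : G → ℝ := fun g => c⁻¹ * b g with hθdef
  have hθ : ContMDiff 𝓘(ℝ, E) 𝓘(ℝ, ℝ) ∞ θ := contMDiff_const.mul b.contMDiff
  have hs : HasCompactSupport θ := b.hasCompactSupport.mul_left
  have hθ0 : ∀ g, 0 ≤ θ g := fun g => mul_nonneg (inv_nonneg.mpr hcpos.le) b.nonneg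
  have hθ1 : ∫ g, θ g⁻¹ ∂ν = 1 := by
    simp only [hθdef]
    rw [integral_const_mul, ← hc, inv_mul_cancel₀ hcpos.ne']
  have hθU : ∀ g, θ g ≠ 0 → ∀ x : G ⧸ Γ, |D x - D (g • x)| < η := fun g hg =>
    hb (subset_tsupport _ (right_ne_zero_of_mul hg))
  obtain ⟨M, hM0, hM⟩ := exists_derivBound_smoothing (ν := ν) (X := G ⧸ Γ) ζ k hθ hs
  refine ⟨M, hM0, fun u => ?_⟩
  set F : G ⧸ Γ → ℝ := {x | u < D x}.indicator fun _ => 1 with hF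
  have hFm : Measurable F := measurable_const.indicator (measurableSet_lt measurable_const hDm)
  have hF0 : ∀ x, 0 ≤ F x := fun x => indicator_nonneg (fun _ _ => zero_le_one) x
  have hF1 : ∀ x, F x ≤ 1 := fun x => indicator_le_self' (fun _ _ => zero_le_one) x
  have hFabs : ∀ x, |F x| ≤ 1 := fun x => by rw [abs_of_nonneg (hF0 x)]; exact hF1 x
  refine ⟨smoothing ν θ F, hM F hFm hFabs, fun x => ⟨?_, ?_⟩, fun x hx => ?_, fun x hx => ?_⟩
  · exact integral_nonneg fun g => mul_nonneg (hθ0 _) (hF0 _)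
  · rw [← hθ1]
    refine integral_mono (integrable_smoothing hθ.continuous hs hFm hFabs x)
      (integrable_comp_inv_of_hasCompactSupport hθ.continuous hs) fun g =>
        mul_le_of_le_one_right (hθ0 _) (hF1 _)
  · rw [← hθ1]
    refine integral_congr_ae (Eventually.of_forall fun g => ?_)
    by_cases hg : θ g⁻¹ = 0
    · simp [hg]
    · have h1 := (abs_lt.mp (hθU _ hg x)).2
      have h3 : g⁻¹ • x ∈ {x | u < D x} := by change u < D (g⁻¹ • x); linarith
      have h2 : F (g⁻¹ • x) = 1 := indicator_of_mem h3 _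
      simp [h2]
  · refine integral_eq_zero_of_ae (Eventually.of_forall fun g => ?_)
    by_cases hg : θ g⁻¹ = 0
    · simp [hg]
    · have h1 := (abs_lt.mp (hθU _ hg x)).1
      have h3 : g⁻¹ • x ∉ {x | u < D x} := by change ¬ u < D (g⁻¹ • x); linarith
      have h2 : F (g⁻¹ • x) = 0 := indicator_of_notMem h3 _
      simp [h2]

end Approximation

/-! ### Counting independent events and Poisson bounds. -/

section BernoulliSums

/-- The probability that fewer than `l` among `n` independent events with probabilities `t i`,
`i < n`, occur. -/
noncomputable def bernoulliCdf (t : ℕ → ℝ) : ℕ → ℕ → ℝ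
  | 0, 0 => 0
  | 0, _ + 1 => 1
  | _ + 1, 0 => 0
  | n + 1, l + 1 => (1 - t n) * bernoulliCdf t n (l + 1) + t n * bernoulliCdf t n l

theorem bernoulliCdf_zero_right (t : ℕ → ℝ) (n : ℕ) : bernoulliCdf t n 0 = 0 := by
  cases n <;> rfl

theorem bernoulliCdf_mem_Icc {t : ℕ → ℝ} (ht : ∀ i, 0 ≤ t i ∧ t i ≤ 1) (n l : ℕ) :
    0 ≤ bernoulliCdf t n l ∧ bernoulliCdf t n l ≤ 1 := by
  induction n generalizing l with
  | zero => cases l <;> simp [bernoulliCdf]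
  | succ n ih =>
    cases l with
    | zero => simp [bernoulliCdf]
    | succ l =>
      have h0 := ht n
      have h1 := ih (l + 1)
      have h2 := ih l
      have h3 := sub_nonneg.mpr h0.2
      rw [bernoulliCdf]
      refine ⟨add_nonneg (mul_nonneg h3 h1.1) (mul_nonneg h0.1 h2.1), ?_⟩
      nlinarith [mul_le_mul_of_nonneg_left h1.2 h3, mul_le_mul_of_nonneg_left h2.2 h0.1]

theorem bernoulliCdf_le_succ {t : ℕ → ℝ} (ht : ∀ i, 0 ≤ t i ∧ t i ≤ 1) (n l : ℕ) :
    bernoulliCdf t n l ≤ bernoulliCdf t n (l + 1) := by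
  induction n generalizing l with
  | zero => cases l <;> simp [bernoulliCdf]
  | succ n ih =>
    cases l with
    | zero => rw [bernoulliCdf_zero_right]; exact (bernoulliCdf_mem_Icc ht _ _).1
    | succ l =>
      rw [bernoulliCdf, bernoulliCdf]
      exact add_le_add (mul_le_mul_of_nonneg_left (ih _) (sub_nonneg.mpr (ht n).2))
        (mul_le_mul_of_nonneg_left (ih _) (ht n).1)

/-- In each variable the function is affine with slope minus a difference of consecutive values in
`l`, which is nonnegative by `bernoulliCdf_le_succ`. -/
theorem bernoulliCdf_anti {s t : ℕ → ℝ} (hs : ∀ i, 0 ≤ s i ∧ s i ≤ 1)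
    (ht : ∀ i, 0 ≤ t i ∧ t i ≤ 1) (hst : ∀ i, s i ≤ t i) (n l : ℕ) :
    bernoulliCdf t n l ≤ bernoulliCdf s n l := by
  induction n generalizing l with
  | zero => cases l <;> simp [bernoulliCdf]
  | succ n ih =>
    cases l with
    | zero => simp [bernoulliCdf]
    | succ l =>
      rw [bernoulliCdf, bernoulliCdf]
      have h1 := mul_le_mul_of_nonneg_left (ih (l + 1)) (sub_nonneg.mpr (hs n).2)
      have h2 := mul_le_mul_of_nonneg_left (ih l) (hs n).1
      have h3 := mul_le_mul_of_nonneg_right (hst n)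
        (sub_nonneg.mpr (bernoulliCdf_le_succ ht n l))
      linarith

theorem bernoulliCdf_indicator (p : ℕ → Prop) [DecidablePred p] (n l : ℕ) :
    bernoulliCdf (fun i => if p i then 1 else 0) n l =
      if ((Finset.range n).filter p).card < l then 1 else 0 := by
  induction n generalizing l with
  | zero => cases l <;> simp [bernoulliCdf]
  | succ n ih =>
    cases l with
    | zero => simp [bernoulliCdf]
    | succ l =>
      rw [bernoulliCdf, ih, ih, Finset.range_add_one, Finset.filter_insert]
      by_cases hp : p n
      · rw [if_pos hp, if_pos hp, Finset.card_insert_of_notMem (by simp)]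
        simp
      · rw [if_neg hp, if_neg hp]
        simp

theorem bernoulliCdf_const (p : ℝ) (n l : ℕ) :
    bernoulliCdf (fun _ => p) n l =
      ∑ i ∈ Finset.range l, (n.choose i : ℝ) * p ^ i * (1 - p) ^ (n - i) := by
  induction n generalizing l with
  | zero =>
    cases l with
    | zero => simp [bernoulliCdf]
    | succ l =>
      rw [Finset.sum_range_succ']
      simp [bernoulliCdf]
  | succ n ih =>
    cases l with
    | zero => simp [bernoulliCdf]
    | succ l =>
      rw [bernoulliCdf, ih, ih, Finset.sum_range_succ', Finset.sum_range_succ', mul_add,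
        Finset.mul_sum, Finset.mul_sum, add_right_comm, ← Finset.sum_add_distrib]
      congr 1
      · refine Finset.sum_congr rfl fun i _ => ?_
        rw [Nat.choose_succ_succ, Nat.cast_add, Nat.add_sub_add_right]
        -- For `i ≥ n` the truncated exponents are wrong, but `n.choose (i + 1)` vanishes.
        rcases lt_or_ge i n with h | h
        · obtain ⟨j, rfl⟩ := Nat.exists_eq_add_of_lt h
          rw [show i + j + 1 - (i + 1) = j by omega, show i + j + 1 - i = j + 1 by omega]
          ring
        · rw [Nat.choose_eq_zero_of_lt (Nat.lt_succ_of_le h)]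
          push_cast
          ring
      · simp only [Nat.choose_zero_right, Nat.sub_zero, pow_succ]
        ring

/-- Termwise: `n.choose i ≤ n ^ i / i!` and `1 - p ≤ exp (-p)`. The mean `n * p` is only pinched, so
its upper bound serves the powers and its lower bound the main exponential. -/
theorem bernoulliCdf_const_le {p lam₁ lam₂ : ℝ} {n : ℕ} (hn : 0 < n) (hp0 : 0 ≤ p) (hp1 : p ≤ 1)
    (h₁ : lam₁ ≤ n * p) (h₂ : n * p ≤ lam₂) (l : ℕ) :
    bernoulliCdf (fun _ => p) n l ≤ Real.exp (-lam₁) * Real.exp (l * (lam₂ / n)) *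
      ∑ i ∈ Finset.range l, lam₂ ^ i / (i.factorial : ℝ) := by
  have hn' : (0 : ℝ) < n := Nat.cast_pos.mpr hn
  have hp2 : p ≤ lam₂ / n := by rw [le_div_iff₀ hn', mul_comm]; exact h₂
  rw [bernoulliCdf_const, Finset.mul_sum]
  refine Finset.sum_le_sum fun i hi => ?_
  have hil : (i : ℝ) ≤ l := by exact_mod_cast (Finset.mem_range.mp hi).le
  have e1 : (n.choose i : ℝ) * p ^ i ≤ lam₂ ^ i / (i.factorial : ℝ) := by
    calc (n.choose i : ℝ) * p ^ i ≤ (n : ℝ) ^ i / (i.factorial : ℝ) * p ^ i :=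
          mul_le_mul_of_nonneg_right (Nat.choose_le_pow_div i n) (pow_nonneg hp0 i)
      _ = (n * p) ^ i / (i.factorial : ℝ) := by rw [mul_pow]; ring
      _ ≤ lam₂ ^ i / (i.factorial : ℝ) := by
          refine div_le_div_of_nonneg_right ?_ (by positivity)
          exact pow_le_pow_left₀ (mul_nonneg hn'.le hp0) h₂ i
  have e2 : (1 - p) ^ (n - i) ≤ Real.exp (-lam₁) * Real.exp (l * (lam₂ / n)) := by
    have h3 : (1 - p) ^ (n - i) ≤ Real.exp (-p) ^ (n - i) :=
      pow_le_pow_left₀ (sub_nonneg.mpr hp1) (Real.one_sub_le_exp_neg p) _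
    refine h3.trans ?_
    rw [← Real.exp_nat_mul, ← Real.exp_add, Real.exp_le_exp]
    have h4 : (n : ℝ) - i ≤ ((n - i : ℕ) : ℝ) := by
      rw [sub_le_iff_le_add]; exact_mod_cast (by omega : n ≤ n - i + i)
    have h5 := mul_le_mul_of_nonneg_right h4 hp0
    have h6 : (i : ℝ) * p ≤ l * (lam₂ / n) :=
      mul_le_mul hil hp2 hp0 (Nat.cast_nonneg l)
    linarith
  rw [mul_comm]
  exact mul_le_mul e2 e1 (mul_nonneg (Nat.cast_nonneg _) (pow_nonneg hp0 i)) (by positivity)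

/-- Termwise: the descending factorial is at least `(n - l) ^ i`, and `log (1 - p) ≥ -p / (1 - p)`.
-/
theorem le_bernoulliCdf_const {p lam₁ lam₂ : ℝ} {n l : ℕ} (hl : l ≤ n) (hp0 : 0 ≤ p)
    (h0 : 0 ≤ lam₁) (h₁ : lam₁ ≤ n * p) (h₂ : n * p ≤ lam₂) (hn : lam₂ < n) :
    Real.exp (-(lam₂ / (1 - lam₂ / n))) *
      ∑ i ∈ Finset.range l, (lam₁ * (1 - l / n)) ^ i / (i.factorial : ℝ) ≤
    bernoulliCdf (fun _ => p) n l := by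
  have hn' : (0 : ℝ) < n := (h0.trans (h₁.trans h₂)).trans_lt hn
  have hp2 : p ≤ lam₂ / n := by rw [le_div_iff₀ hn', mul_comm]; exact h₂
  have hq : lam₂ / n < 1 := by rw [div_lt_one hn']; exact hn
  have hp1 : 0 < 1 - p := by linarith
  rw [bernoulliCdf_const, Finset.mul_sum]
  refine Finset.sum_le_sum fun i hi => ?_
  have hil : i < l := Finset.mem_range.mp hi
  have hnl : (0 : ℝ) ≤ 1 - l / n := by
    rw [sub_nonneg, div_le_one hn']; exact_mod_cast hl
  have e1 : (lam₁ * (1 - l / n)) ^ i / (i.factorial : ℝ) ≤ (n.choose i : ℝ) * p ^ i := by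
    rw [Nat.choose_eq_descFactorial_div_factorial,
      Nat.cast_div (Nat.factorial_dvd_descFactorial n i) (by positivity), div_mul_eq_mul_div]
    refine div_le_div_of_nonneg_right ?_ (by positivity)
    have h3 : ((n - l : ℕ) : ℝ) ^ i ≤ (n.descFactorial i : ℝ) := by
      refine le_trans ?_ (Nat.cast_le.mpr (Nat.pow_sub_le_descFactorial n i))
      push_cast
      refine pow_le_pow_left₀ (Nat.cast_nonneg _) ?_ i
      exact_mod_cast (by omega : n - l ≤ n + 1 - i)
    rw [Nat.cast_sub hl] at h3
    have h4 : lam₁ * (1 - l / n) ≤ ((n : ℝ) - l) * p := by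
      refine (mul_le_mul_of_nonneg_right h₁ hnl).trans_eq ?_
      field_simp
    calc (lam₁ * (1 - l / n)) ^ i ≤ (((n : ℝ) - l) * p) ^ i :=
          pow_le_pow_left₀ (mul_nonneg h0 hnl) h4 i
      _ = ((n : ℝ) - l) ^ i * p ^ i := mul_pow _ _ _
      _ ≤ _ := mul_le_mul_of_nonneg_right h3 (pow_nonneg hp0 i)
  have e2 : Real.exp (-(lam₂ / (1 - lam₂ / n))) ≤ (1 - p) ^ (n - i) := by
    have h3 : (1 - p) ^ n ≤ (1 - p) ^ (n - i) :=
      pow_le_pow_of_le_one hp1.le (by linarith) (Nat.sub_le n i)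
    refine le_trans ?_ h3
    rw [← Real.exp_log hp1, ← Real.exp_nat_mul, Real.exp_le_exp]
    have h5 : 1 - (1 - p)⁻¹ ≤ Real.log (1 - p) := Real.one_sub_inv_le_log_of_pos hp1
    have h6 : n * (1 - (1 - p)⁻¹) ≤ n * Real.log (1 - p) := mul_le_mul_of_nonneg_left h5 hn'.le
    refine le_trans ?_ h6
    have h7 : (n : ℝ) * (1 - (1 - p)⁻¹) = -(n * p / (1 - p)) := by field_simp; ring
    rw [h7, neg_le_neg_iff]
    exact div_le_div₀ ((mul_nonneg hn'.le hp0).trans h₂) h₂ (by linarith) (by linarith)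
  rw [mul_comm (_ * _)]
  exact mul_le_mul e2 e1 (by positivity) (pow_nonneg hp1.le _)

end BernoulliSums

/-- With `K < ρ ^ s`, the Taylor term of order `s + 1` of the exponential beats `K ^ j` by a factor
of order `ρ ^ j`. -/
theorem summable_pow_mul_exp_neg_mul_pow {K b ρ : ℝ} (hK : 0 ≤ K) (hb : 0 < b) (hρ : 1 < ρ) :
    Summable fun j : ℕ => K ^ j * Real.exp (-(b * ρ ^ j)) := by
  obtain ⟨s, hs⟩ := pow_unbounded_of_one_lt K hρ
  have hρ0 : 0 < ρ := zero_lt_one.trans hρ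
  refine Summable.of_nonneg_of_le (fun j => by positivity) (fun j => ?_)
    ((summable_geometric_of_lt_one (inv_nonneg.mpr hρ0.le) (inv_lt_one_of_one_lt₀ hρ)).mul_left
      (((s + 1).factorial : ℝ) / b ^ (s + 1)))
  have h1 : (b * ρ ^ j) ^ (s + 1) / ((s + 1).factorial : ℝ) ≤ Real.exp (b * ρ ^ j) :=
    Real.pow_div_factorial_le_exp _ (by positivity) _
  have h2 : K ^ j ≤ (ρ ^ j) ^ s := by
    rw [← pow_mul, mul_comm, pow_mul]
    exact pow_le_pow_left₀ hK hs.le j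
  rw [Real.exp_neg]
  calc K ^ j * (Real.exp (b * ρ ^ j))⁻¹
      ≤ (ρ ^ j) ^ s * ((b * ρ ^ j) ^ (s + 1) / ((s + 1).factorial : ℝ))⁻¹ :=
        mul_le_mul h2 (inv_anti₀ (by positivity) h1) (by positivity) (by positivity)
    _ = ((s + 1).factorial : ℝ) / b ^ (s + 1) * ρ⁻¹ ^ j := by
        rw [inv_pow]
        field_simp
        ring

theorem measurable_bernoulliCdf {X : Type*} [MeasurableSpace X] {ψ : ℕ → X → ℝ}
    (hψ : ∀ i, Measurable (ψ i)) (n l : ℕ) :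
    Measurable fun x => bernoulliCdf (fun i => ψ i x) n l := by
  induction n generalizing l with
  | zero => cases l <;> exact measurable_const
  | succ n ih =>
    cases l with
    | zero => exact measurable_const
    | succ l => exact ((measurable_const.sub (hψ n)).mul (ih (l + 1))).add ((hψ n).mul (ih l))

theorem integrable_bernoulliCdf {X : Type*} [MeasurableSpace X] {μ : Measure X}
    [IsFiniteMeasure μ] {ψ : ℕ → X → ℝ} (hψ : ∀ i, Measurable (ψ i))
    (h01 : ∀ i x, 0 ≤ ψ i x ∧ ψ i x ≤ 1) (n l : ℕ) :
    Integrable (fun x => bernoulliCdf (fun i => ψ i x) n l) μ := by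
  refine Integrable.of_bound (measurable_bernoulliCdf hψ n l).aestronglyMeasurable 1
    (Eventually.of_forall fun x => ?_)
  have h := bernoulliCdf_mem_Icc (fun i => h01 i x) n l
  rw [Real.norm_eq_abs, abs_of_nonneg h.1]
  exact h.2

/-- If each `ψ n` is almost uncorrelated with functions of the preceding ones, then the
`bernoulliCdf` of the `ψ i` has mean close to that of independent events of probability `p`. -/
theorem abs_integral_bernoulliCdf_sub_le {X : Type*} [MeasurableSpace X] {μ : Measure X}
    [IsProbabilityMeasure μ] {ψ : ℕ → X → ℝ} (hψ : ∀ i, Measurable (ψ i))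
    (h01 : ∀ i x, 0 ≤ ψ i x ∧ ψ i x ≤ 1) {p : ℝ} (hp0 : 0 ≤ p) (hp1 : p ≤ 1) {e : ℕ → ℝ}
    (he : ∀ n, 0 ≤ e n)
    (h : ∀ n l, |(∫ x, (bernoulliCdf (fun i => ψ i x) n (l + 1) -
        bernoulliCdf (fun i => ψ i x) n l) * ψ n x ∂μ) -
      (∫ x, (bernoulliCdf (fun i => ψ i x) n (l + 1) -
        bernoulliCdf (fun i => ψ i x) n l) ∂μ) * p| ≤ e n) (n l : ℕ) :
    |(∫ x, bernoulliCdf (fun i => ψ i x) n l ∂μ) - bernoulliCdf (fun _ => p) n l| ≤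
      ∑ i ∈ Finset.range n, e i := by
  induction n generalizing l with
  | zero => cases l <;> simp [bernoulliCdf]
  | succ n ih =>
    have hs : 0 ≤ ∑ i ∈ Finset.range (n + 1), e i := Finset.sum_nonneg fun i _ => he i
    cases l with
    | zero => simpa [bernoulliCdf] using hs
    | succ l =>
      have i1 := integrable_bernoulliCdf (μ := μ) hψ h01 n (l + 1)
      have i0 := integrable_bernoulliCdf (μ := μ) hψ h01 n l
      have hd : Integrable (fun x => (bernoulliCdf (fun i => ψ i x) n (l + 1) -
          bernoulliCdf (fun i => ψ i x) n l) * ψ n x) μ :=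
        (i1.sub i0).mul_bdd (c := 1) (hψ n).aestronglyMeasurable (Eventually.of_forall fun x => by
          rw [Real.norm_eq_abs, abs_of_nonneg (h01 n x).1]; exact (h01 n x).2)
      -- Only the difference of consecutive values in `l`, a function of the earlier variables, is
      -- correlated with `ψ n`.
      have e1 : (∫ x, bernoulliCdf (fun i => ψ i x) (n + 1) (l + 1) ∂μ) =
          (∫ x, bernoulliCdf (fun i => ψ i x) n (l + 1) ∂μ) -
          ∫ x, (bernoulliCdf (fun i => ψ i x) n (l + 1) -
          bernoulliCdf (fun i => ψ i x) n l) * ψ n x ∂μ := by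
        rw [← integral_sub i1 hd]
        refine integral_congr_ae (Eventually.of_forall fun x => ?_)
        simp only [bernoulliCdf]
        ring
      have h0 := h n l
      rw [integral_sub i1 i0] at h0
      rw [e1, bernoulliCdf, Finset.sum_range_succ]
      have h1 := ih (l + 1)
      have h2 := ih l
      set I1 := ∫ x, bernoulliCdf (fun i => ψ i x) n (l + 1) ∂μ
      set I0 := ∫ x, bernoulliCdf (fun i => ψ i x) n l ∂μ
      set J := ∫ x, (bernoulliCdf (fun i => ψ i x) n (l + 1) -
          bernoulliCdf (fun i => ψ i x) n l) * ψ n x ∂μ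
      rw [abs_le] at h0 h1 h2 ⊢
      -- The two inductive errors are averaged with weights `1 - p` and `p`, so each step merely
      -- adds `e n`.
      have hq := sub_nonneg.mpr hp1
      constructor
      · nlinarith [mul_le_mul_of_nonneg_left h1.1 hq, mul_le_mul_of_nonneg_left h2.1 hp0]
      · nlinarith [mul_le_mul_of_nonneg_left h1.2 hq, mul_le_mul_of_nonneg_left h2.2 hp0]

/-! ### Decorrelation along the orbit from exponential mixing. -/

section Decorrelation

variable {E : Type*} [NormedAddCommGroup E] [NormedSpace ℝ E]
  {G : Type*} [TopologicalSpace G] [ChartedSpace E G] [Group G]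
  {X : Type*} [MulAction G X] [MeasurableSpace X]
  {d : ℕ} {ζ : Module.Basis (Fin d) ℝ (GroupLieAlgebra 𝓘(ℝ, E) G)}

/-- One recursion step multiplies by `1 - ψ n` and by `ψ n`, bounded by `1 + M` and `M`; this costs
`2 ^ k * (1 + 2 * M)` per factor. -/
theorem derivBound_bernoulliCdf (h0 : ∀ i, lieExp ((0 : ℝ) • ζ i) = 1) {k : ℕ} {M A : ℝ}
    (hM : 0 ≤ M) (hA : 0 ≤ A) {ψ : ℕ → X → ℝ} {n : ℕ} (hψ : ∀ i < n, DerivBound ζ k M A (ψ i))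
    (l : ℕ) :
    DerivBound ζ k ((2 ^ k * (1 + 2 * M)) ^ n) A fun x => bernoulliCdf (fun i => ψ i x) n l := by
  have hK : 0 ≤ 2 ^ k * (1 + 2 * M) := by positivity
  induction n generalizing l with
  | zero =>
    cases l with
    | zero => exact DerivBound.const (c := 0) (by simp) hA
    | succ l => exact DerivBound.const (c := 1) (by simp) hA
  | succ n ih =>
    cases l with
    | zero => exact DerivBound.const (c := 0) (by rw [abs_zero]; exact pow_nonneg hK _) hA
    | succ l =>
      have hi := fun l => ih (fun i hi => hψ i (Nat.lt_succ_of_lt hi)) l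
      have hn := hψ n n.lt_succ_self
      have h1 : DerivBound ζ k 1 A (fun _ : X => (1 : ℝ)) := DerivBound.const (by simp) hA
      have h2 := ((h1.sub hn).mul h0 (by positivity) (pow_nonneg hK n) hA (hi (l + 1))).add
        (hn.mul h0 hM (pow_nonneg hK n) hA (hi l))
      rwa [show 2 ^ k * ((1 + M) * (2 ^ k * (1 + 2 * M)) ^ n) +
        2 ^ k * (M * (2 ^ k * (1 + 2 * M)) ^ n) = (2 ^ k * (1 + 2 * M)) ^ (n + 1) by ring] at h2

variable [FiniteDimensional ℝ E] [T2Space G] [LieGroup 𝓘(ℝ, E) ∞ G] [MeasurableConstSMul G X]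
  {μ : Measure X} [IsProbabilityMeasure μ]

/-- The error depends only on the first index `α` and not on the number `n` of factors: the
correlation bounds of the successive indices are summable, because `m` grows exponentially. Hence
no relation between the length and the position of a block is needed. -/
theorem exists_tendsto_bernoulliCdf_error {a : Multiplicative ℝ →ₜ* G} {γs : Fin d → ℝ}
    (hAd : ∀ (i : Fin d) (t : ℝ),
      lieAd (a (Multiplicative.ofAdd t)) (ζ i) = Real.exp (γs i * t) • ζ i)
    {γ : ℝ} (hγ0 : 0 < γ) (hγ : ∀ i, γs i ≤ γ) {k : ℕ} {δ : ℝ}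
    (hmix : ExpDecayOfCorrelations ζ μ a k δ) {m : ℕ → ℝ} (hm : ∀ j, 0 < m j)
    {ρ : ℝ} (hρ : 1 < ρ) (hmρ : ∀ j, ρ * m j ≤ m (j + 1)) (hδ : k * γ < δ * ρ)
    {M : ℝ} (hM : 0 ≤ M) :
    ∃ err : ℕ → ℝ, Tendsto err atTop (𝓝 0) ∧ ∀ f : X → ℝ, DerivBound ζ k M 1 f →
      (∀ x, 0 ≤ f x ∧ f x ≤ 1) → ∀ α n l : ℕ,
      |(∫ x, bernoulliCdf (fun i => f (a (Multiplicative.ofAdd (m (α + i))) • x)) n l ∂μ) -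
        bernoulliCdf (fun _ => ∫ x, f x ∂μ) n l| ≤ err α := by
  obtain ⟨c, hc, hmix⟩ := hmix
  have hρ0 : 0 < ρ := zero_lt_one.trans hρ
  have hmono : Monotone m := monotone_nat_of_le_succ fun j =>
    (le_mul_of_one_le_left (hm j).le hρ.le).trans (hmρ j)
  have hgrow : ∀ j, m 0 * ρ ^ j ≤ m j := fun j => by
    induction j with
    | zero => simp
    | succ j ih =>
      rw [pow_succ, ← mul_assoc, mul_comm]
      exact (mul_le_mul_of_nonneg_left ih hρ0.le).trans (hmρ j)
  have hgap : ∀ i j, i < j → m i ≤ m j / ρ := fun i j hij => by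
    rw [le_div_iff₀ hρ0, mul_comm]
    exact (hmρ i).trans (hmono hij)
  have h0 : ∀ i, lieExp ((0 : ℝ) • ζ i) = 1 := fun i => by
    obtain ⟨φ, v, -, hφ⟩ := exists_oneParam_lieExp (ζ i)
    rw [hφ, ofAdd_zero, map_one]
  -- The net rate: decay `δ` against `k` derivatives, each expanded by at most `exp (γ * m j / ρ)`
  -- at the times before `m j`.
  set b : ℝ := δ - k * γ / ρ with hb
  have hb0 : 0 < b := by rw [hb, sub_pos, div_lt_iff₀ hρ0]; exact hδ
  set S : ℝ := √(∑ l ∈ Finset.range (k + 1), (d : ℝ) ^ l) with hS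
  have hS0 : 0 ≤ S := Real.sqrt_nonneg _
  set K : ℝ := 2 ^ k * (1 + 2 * M) with hKdef
  have hK1 : 1 ≤ K := one_le_mul_of_one_le_of_one_le (one_le_pow₀ one_le_two) (by linarith)
  have hK0 : 0 ≤ K := zero_le_one.trans hK1
  set C : ℝ := c * S * 2 * (S * M) with hC
  have hC0 : 0 ≤ C := by positivity
  -- Indexed by the absolute position `j = n + α`, with `K ^ j ≥ K ^ n`, so that every block error
  -- is bounded by a tail of one convergent series.
  set ε : ℕ → ℝ := fun j => C * (K ^ j * Real.exp (-(b * m 0 * ρ ^ j))) with hε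
  have hε0 : ∀ j, 0 ≤ ε j := fun j => by positivity
  have hsum : Summable ε :=
    (summable_pow_mul_exp_neg_mul_pow hK0 (mul_pos hb0 (hm 0)) hρ).mul_left C
  refine ⟨fun α => ∑' j, ε (j + α), tendsto_sum_nat_add ε, fun f hf hf01 α n l => ?_⟩
  set ψ : ℕ → X → ℝ := fun i x => f (a (Multiplicative.ofAdd (m (α + i))) • x) with hψ
  have hψm : ∀ i, Measurable (ψ i) := fun i => hf.measurable.comp (measurable_const_smul _)
  have hψ01 : ∀ i x, 0 ≤ ψ i x ∧ ψ i x ≤ 1 := fun i x => hf01 _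
  have hfi : Integrable f μ := Integrable.of_bound hf.measurable.aestronglyMeasurable 1
    (Eventually.of_forall fun x => by
      rw [Real.norm_eq_abs, abs_of_nonneg (hf01 x).1]; exact (hf01 x).2)
  have hp0 : 0 ≤ ∫ x, f x ∂μ := integral_nonneg fun x => (hf01 x).1
  have hp1 : ∫ x, f x ∂μ ≤ 1 := by
    have := integral_mono (μ := μ) hfi (integrable_const 1) fun x => (hf01 x).2
    simpa using this
  refine (abs_integral_bernoulliCdf_sub_le (e := fun i => ε (i + α)) hψm hψ01 hp0 hp1
    (fun i => hε0 _) (fun n l => ?_) n l).trans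
    ((((summable_nat_add_iff α).mpr hsum).sum_le_tsum _ fun i _ => hε0 _))
  set B : ℝ := Real.exp (γ * (m (α + n) / ρ)) with hB
  have hB1 : 1 ≤ B := Real.one_le_exp (by have := hm (α + n); positivity)
  have hψB : ∀ i < n, DerivBound ζ k M B (ψ i) := fun i hi => by
    have hmi := (hm (α + i)).le
    have h := hf.comp_smul (h := a (Multiplicative.ofAdd (m (α + i))))
      (c := fun j => Real.exp (γs j * m (α + i))) (C := Real.exp (γ * m (α + i)))
      (fun j t => conj_lieExp_of_lieAd_eq_smul (hAd j _) t)
      (fun j => by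
        rw [Real.abs_exp, Real.exp_le_exp]
        exact mul_le_mul_of_nonneg_right (hγ j) hmi) (Real.exp_nonneg _) hM zero_le_one
    rw [mul_one] at h
    exact h.mono hM le_rfl (Real.exp_nonneg _) (Real.exp_le_exp.mpr
      (mul_le_mul_of_nonneg_left (hgap _ _ (by omega)) hγ0.le))
  have hg := (derivBound_bernoulliCdf h0 hM (zero_le_one.trans hB1) hψB (l + 1)).sub
    (derivBound_bernoulliCdf h0 hM (zero_le_one.trans hB1) hψB l)
  have hmx := hmix _ f hg.memSobolev hf.memSobolev (m (α + n)) (hm _).le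
  refine hmx.trans ?_
  have s1 := hg.sobolevNorm_le (μ := μ) (by positivity) hB1
  have s2 := hf.sobolevNorm_le (μ := μ) hM le_rfl
  rw [one_pow, one_mul] at s2
  have hn2 : 0 ≤ sobolevNorm ζ μ k f := Real.sqrt_nonneg _
  have hexp : Real.exp (-δ * m (α + n)) * B ^ k ≤ Real.exp (-(b * m 0 * ρ ^ (n + α))) := by
    rw [hB, ← Real.exp_nat_mul, ← Real.exp_add, Real.exp_le_exp, add_comm n α, mul_assoc b]
    have h1 := mul_le_mul_of_nonneg_left (hgrow (α + n)) hb0.le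
    have h2 : -δ * m (α + n) + k * (γ * (m (α + n) / ρ)) = -(b * m (α + n)) := by
      rw [hb]; ring
    rw [h2]
    exact neg_le_neg h1
  calc c * Real.exp (-δ * m (α + n)) * _ * sobolevNorm ζ μ k f
      ≤ c * Real.exp (-δ * m (α + n)) * (S * (B ^ k * (K ^ n + K ^ n))) * (S * M) :=
        mul_le_mul (mul_le_mul_of_nonneg_left s1 (by positivity)) s2 hn2 (by positivity)
    _ = C * (K ^ n * (Real.exp (-δ * m (α + n)) * B ^ k)) := by rw [hC]; ring
    _ ≤ ε (n + α) := by
        refine mul_le_mul_of_nonneg_left ?_ hC0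
        exact mul_le_mul (pow_le_pow_right₀ hK1 (Nat.le_add_right n α)) hexp (by positivity)
          (by positivity)

end Decorrelation

/-! ### Order statistics as counts of exceedances. -/

section OrderStatistics

/-- Entries are numbered from `0`, whence `l + 1`. If the head is at most `u`, so is every entry;
otherwise it counts once and is removed. -/
theorem getD_le_iff_countP_lt_of_pairwise_ge {L : List ℝ} (hL : L.Pairwise (· ≥ ·)) (u : ℝ) {l : ℕ}
    (hl : l < L.length) : L.getD l 0 ≤ u ↔ L.countP (fun y => decide (u < y)) < l + 1 := by
  induction L generalizing l with
  | nil => simp at hl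
  | cons x L ih =>
    rw [List.pairwise_cons] at hL
    rcases lt_or_ge u x with hx | hx
    · rw [List.countP_cons_of_pos (by simpa using hx)]
      cases l with
      | zero => simp [hx]
      | succ l =>
        rw [List.getD_cons_succ, ih hL.2 (by simpa using hl), Nat.add_lt_add_iff_right]
    · have h0 : (x :: L).countP (fun y => decide (u < y)) = 0 := by
        rw [List.countP_eq_zero]
        intro y hy
        rcases List.mem_cons.mp hy with rfl | hy
        · simpa using hx
        · simpa using (hL.1 y hy).trans hx
      rw [h0]
      refine iff_of_true ?_ l.succ_pos
      rw [List.getD_eq_getElem _ _ hl]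
      rcases List.mem_cons.mp (List.getElem_mem hl) with h | h
      · rw [h]; exact hx
      · exact (hL.1 _ h).trans hx

theorem kthLargest_le_iff {ι : Type*} (s : Finset ι) (ξ : ι → ℝ) {l : ℕ} (hl : 1 ≤ l)
    (hls : l ≤ s.card) (u : ℝ) : kthLargest s ξ l ≤ u ↔ (s.filter fun j => u < ξ j).card < l := by
  unfold kthLargest
  rw [getD_le_iff_countP_lt_of_pairwise_ge (Multiset.pairwise_sort _ _) u
    (by rw [Multiset.length_sort, Multiset.card_map, Finset.card_val]; omega),
    ← Multiset.coe_countP, Multiset.sort_eq, Multiset.countP_map, Nat.sub_add_cancel hl]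
  rfl

theorem orbitMax_le_iff {G X : Type*} [TopologicalSpace G] [Group G] [MulAction G X]
    (a : Multiplicative ℝ →ₜ* G) (D : X → ℝ) (m : ℕ → ℝ) {α β l : ℕ} (hl : 1 ≤ l)
    (hlN : l ≤ β - α + 1) (hαβ : α < β) (x : X) (u : ℝ) :
    orbitMax a D m α β l x ≤ u ↔ ((Finset.range (β - α + 1)).filter fun i =>
      u < D (a (Multiplicative.ofAdd (m (α + i))) • x)).card < l := by
  unfold orbitMax
  rw [kthLargest_le_iff _ _ hl (by rw [Nat.card_Icc]; omega)]
  have h : Finset.Icc α β = (Finset.range (β - α + 1)).map (addLeftEmbedding α) := by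
    rw [Finset.range_eq_Ico, Finset.map_add_left_Ico]
    ext j
    simp only [Finset.mem_Icc, Finset.mem_Ico]
    omega
  rw [h, Finset.filter_map, Finset.card_map]
  rfl

end OrderStatistics

/-! ### Asymptotic bounds at fixed smoothing width. -/

section Limits

variable {X : Type*} [MeasurableSpace X] {μ : Measure X} [IsProbabilityMeasure μ]

theorem tailDist_le_integral_le {D : X → ℝ} (hD : Measurable D) {f : X → ℝ} (hf : Measurable f)
    (hf01 : ∀ x, 0 ≤ f x ∧ f x ≤ 1) {u₀ u₁ : ℝ} (h1 : ∀ x, u₁ ≤ D x → f x = 1)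
    (h0 : ∀ x, D x ≤ u₀ → f x = 0) :
    tailDist μ D u₁ ≤ ∫ x, f x ∂μ ∧ ∫ x, f x ∂μ ≤ tailDist μ D u₀ := by
  have hfi : Integrable f μ := Integrable.of_bound hf.aestronglyMeasurable 1
    (Eventually.of_forall fun x => by
      rw [Real.norm_eq_abs, abs_of_nonneg (hf01 x).1]; exact (hf01 x).2)
  have hs : ∀ u, MeasurableSet {x | u ≤ D x} := fun u => measurableSet_le measurable_const hD
  have hi : ∀ u, Integrable ({x | u ≤ D x}.indicator (1 : X → ℝ)) μ := fun u =>
    (integrable_const (1 : ℝ)).indicator (hs u)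
  unfold tailDist
  rw [← integral_indicator_one (hs u₁), ← integral_indicator_one (hs u₀)]
  refine ⟨integral_mono (hi u₁) hfi fun x => ?_, integral_mono hfi (hi u₀) fun x => ?_⟩
  · by_cases hx : x ∈ {x | u₁ ≤ D x}
    · rw [indicator_of_mem hx, h1 x hx, Pi.one_apply]
    · rw [indicator_of_notMem hx]; exact (hf01 x).1
  · by_cases hx : x ∈ {x | u₀ ≤ D x}
    · rw [indicator_of_mem hx]; exact (hf01 x).2
    · rw [indicator_of_notMem hx, h0 x (le_of_not_ge hx)]

/-- Asymptotic bounds for the law of the order statistics of a stationary sequence whose level sets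
are separated by functions satisfying a quantitative independence estimate. -/
theorem exists_tendsto_bounds_of_separated {T : ℕ → X → X} (hT : ∀ j, MeasurePreserving (T j) μ μ)
    {𝓒 : ℝ → (X → ℝ) → Prop} (hmeas : ∀ M f, 𝓒 M f → Measurable f) {D : X → ℝ} (hD : Measurable D)
    (hsep : ∀ η : ℝ, 0 < η → ∃ M : ℝ, 0 ≤ M ∧ ∀ u : ℝ, ∃ f : X → ℝ, 𝓒 M f ∧
      (∀ x, 0 ≤ f x ∧ f x ≤ 1) ∧ (∀ x, u + η ≤ D x → f x = 1) ∧ ∀ x, D x ≤ u - η → f x = 0)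
    (herr : ∀ M : ℝ, 0 ≤ M → ∃ err : ℕ → ℝ, Tendsto err atTop (𝓝 0) ∧ ∀ f : X → ℝ, 𝓒 M f →
      (∀ x, 0 ≤ f x ∧ f x ≤ 1) → ∀ α n l : ℕ,
      |(∫ x, bernoulliCdf (fun i => f (T (α + i) x)) n l ∂μ) -
        bernoulliCdf (fun _ => ∫ x, f x ∂μ) n l| ≤ err α)
    {α N : ℕ → ℕ} (hα : Tendsto α atTop atTop) (hN : Tendsto N atTop atTop) (hN0 : ∀ n, 0 < N n)
    {w₁ w₂ v : ℝ} (hw₁ : 0 < w₁) (hv : 0 < v)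
    (hΦ : ∀ᶠ z in atTop, w₁ * Real.exp (-v * z) ≤ tailDist μ D z ∧
      tailDist μ D z ≤ w₂ * Real.exp (-v * z)) (l : ℕ) (r : ℝ) {η : ℝ} (hη : 0 < η) :
    ∃ lo hi : ℕ → ℝ,
      Tendsto lo atTop (𝓝 (Real.exp (-(w₂ * Real.exp (-v * (r - 2 * η)))) *
        ∑ i ∈ Finset.range l, (w₁ * Real.exp (-v * r)) ^ i / (i.factorial : ℝ))) ∧
      Tendsto hi atTop (𝓝 (Real.exp (-(w₁ * Real.exp (-v * (r + 2 * η)))) *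
        ∑ i ∈ Finset.range l, (w₂ * Real.exp (-v * r)) ^ i / (i.factorial : ℝ))) ∧
      ∀ᶠ n in atTop,
        lo n ≤ μ.real {x | ((Finset.range (N n)).filter fun i =>
          r + 1 / v * Real.log (N n) < D (T (α n + i) x)).card < l} ∧
        μ.real {x | ((Finset.range (N n)).filter fun i =>
          r + 1 / v * Real.log (N n) < D (T (α n + i) x)).card < l} ≤ hi n := by
  obtain ⟨M, hM0, hM⟩ := hsep η hη
  obtain ⟨err, herr0, herr⟩ := herr M hM0
  choose F hFC hF01 hF1 hF0 using hM
  set u : ℕ → ℝ := fun n => r + 1 / v * Real.log (N n) with hu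
  have hNr : Tendsto (fun n => (N n : ℝ)) atTop atTop := tendsto_natCast_atTop_atTop.comp hN
  have hut : Tendsto u atTop atTop := tendsto_atTop_add_const_left _ _
    ((Real.tendsto_log_atTop.comp hNr).const_mul_atTop (by positivity))
  have hFm : ∀ s, Measurable (F s) := fun s => hmeas M _ (hFC s)
  -- the scaling of the tail at the thresholds
  have hscale : ∀ n s, (N n : ℝ) * Real.exp (-v * (u n + s)) = Real.exp (-v * (r + s)) := by
    intro n s
    have hpos : (0 : ℝ) < N n := Nat.cast_pos.mpr (hN0 n)
    have h1 : -v * (u n + s) = -v * (r + s) + -Real.log (N n) := by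
      simp only [hu]; field_simp; ring
    rw [h1, Real.exp_add, Real.exp_neg, Real.exp_log hpos]
    field_simp
  have htail : ∀ s, ∀ᶠ n in atTop, w₁ * Real.exp (-v * (r + s)) ≤ N n * tailDist μ D (u n + s) ∧
      N n * tailDist μ D (u n + s) ≤ w₂ * Real.exp (-v * (r + s)) := by
    intro s
    filter_upwards [(tendsto_atTop_add_const_right _ s hut).eventually hΦ] with n hn
    have hpos : (0 : ℝ) ≤ N n := Nat.cast_nonneg _
    have h1 := mul_le_mul_of_nonneg_left hn.1 hpos
    have h2 := mul_le_mul_of_nonneg_left hn.2 hpos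
    rw [mul_left_comm, hscale] at h1 h2
    exact ⟨h1, h2⟩
  -- the measure is the integral of the functional of indicators
  have hset : ∀ n, μ.real {x | ((Finset.range (N n)).filter fun i =>
      u n < D (T (α n + i) x)).card < l} =
      ∫ x, bernoulliCdf (fun i => if u n < D (T (α n + i) x) then 1 else 0) (N n) l ∂μ := by
    intro n
    have hm : Measurable fun x =>
        bernoulliCdf (fun i => if u n < D (T (α n + i) x) then 1 else 0) (N n) l :=
      measurable_bernoulliCdf (ψ := fun i x => if u n < D (T (α n + i) x) then (1 : ℝ) else 0)
        (fun i => Measurable.ite (measurableSet_lt measurable_const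
          (hD.comp (hT _).measurable)) measurable_const measurable_const) _ _
    have heq : {x | ((Finset.range (N n)).filter fun i =>
      u n < D (T (α n + i) x)).card < l} = (fun x =>
        bernoulliCdf (fun i => if u n < D (T (α n + i) x) then 1 else 0) (N n) l) ⁻¹' {1} := by
      ext x
      simp only [mem_preimage, mem_singleton_iff, bernoulliCdf_indicator, mem_ofPred_eq]
      split_ifs with h <;> simp [h]
    rw [← integral_indicator_one (heq ▸ hm (measurableSet_singleton 1))]
    refine integral_congr_ae (Eventually.of_forall fun x => ?_)
    simp only [bernoulliCdf_indicator, indicator_apply, mem_ofPred_eq, Pi.one_apply]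
  have hind01 : ∀ (P : Prop) [Decidable P], (0 : ℝ) ≤ (if P then 1 else 0) ∧
      (if P then 1 else 0) ≤ (1 : ℝ) := fun P _ => by split_ifs <;> simp
  have hint : ∀ n s, Integrable (fun x =>
      bernoulliCdf (fun i => F s (T (α n + i) x)) (N n) l) μ := fun n s =>
    integrable_bernoulliCdf (ψ := fun i x => F s (T (α n + i) x))
      (fun i => (hFm s).comp (hT _).measurable) (fun i x => hF01 s _) _ _
  have hint' : ∀ n, Integrable (fun x =>
      bernoulliCdf (fun i => if u n < D (T (α n + i) x) then 1 else 0) (N n) l) μ := fun n =>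
    integrable_bernoulliCdf (ψ := fun i x => if u n < D (T (α n + i) x) then (1 : ℝ) else 0)
      (fun i => Measurable.ite (measurableSet_lt measurable_const
        (hD.comp (hT _).measurable)) measurable_const measurable_const) (fun i x => hind01 _) _ _
  -- `F (u n - η)` is `1` above `u n`, so it dominates the indicator and antitonicity gives a lower
  -- bound. Its mean lies between the tails at `u n` and `u n - 2 * η`.
  have hlow : ∀ n, bernoulliCdf (fun _ => ∫ x, F (u n - η) x ∂μ) (N n) l - err (α n) ≤
      μ.real {x | ((Finset.range (N n)).filter fun i => u n < D (T (α n + i) x)).card < l} := by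
    intro n
    have h1 := (abs_le.mp (herr _ (hFC (u n - η)) (hF01 _) (α n) (N n) l)).1
    have h2 : (∫ x, bernoulliCdf (fun i => F (u n - η) (T (α n + i) x)) (N n) l ∂μ) ≤
        ∫ x, bernoulliCdf (fun i => if u n < D (T (α n + i) x) then 1 else 0) (N n) l ∂μ := by
      refine integral_mono (hint n _) (hint' n) fun x => ?_
      refine bernoulliCdf_anti (fun i => hind01 _) (fun i => hF01 _ _) (fun i => ?_) _ _
      split_ifs with h
      · exact (hF1 _ _ (by linarith)).ge
      · exact (hF01 _ _).1
    rw [hset]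
    linarith
  -- Dually, `F (u n + η)` vanishes up to `u n`, and its mean lies between the tails at `u n + 2 *
  -- η` and `u n`.
  have hupp : ∀ n, μ.real {x | ((Finset.range (N n)).filter fun i =>
      u n < D (T (α n + i) x)).card < l} ≤
      bernoulliCdf (fun _ => ∫ x, F (u n + η) x ∂μ) (N n) l + err (α n) := by
    intro n
    have h1 := (abs_le.mp (herr _ (hFC (u n + η)) (hF01 _) (α n) (N n) l)).2
    have h2 : (∫ x, bernoulliCdf (fun i => if u n < D (T (α n + i) x) then 1 else 0) (N n) l ∂μ) ≤
        ∫ x, bernoulliCdf (fun i => F (u n + η) (T (α n + i) x)) (N n) l ∂μ := by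
      refine integral_mono (hint' n) (hint n _) fun x => ?_
      refine bernoulliCdf_anti (fun i => hF01 _ _) (fun i => hind01 _) (fun i => ?_) _ _
      split_ifs with h
      · exact (hF01 _ _).2
      · exact (hF0 _ _ (by linarith)).le
    rw [hset]
    linarith
  have herrα : Tendsto (fun n => err (α n)) atTop (𝓝 0) := herr0.comp hα
  have hdiv : ∀ s : ℝ, Tendsto (fun n => s / (N n : ℝ)) atTop (𝓝 0) := fun s =>
    tendsto_const_nhds.div_atTop hNr
  set lamA : ℝ := w₁ * Real.exp (-v * r) with hlamA
  set lamB : ℝ := w₂ * Real.exp (-v * (r - 2 * η)) with hlamB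
  set lamC : ℝ := w₁ * Real.exp (-v * (r + 2 * η)) with hlamC
  set lamD : ℝ := w₂ * Real.exp (-v * r) with hlamD
  have h0 := htail 0
  have hm2 := htail (-(2 * η))
  have hp2 := htail (2 * η)
  simp only [add_zero, ← sub_eq_add_neg] at h0 hm2
  have hpF : ∀ s, 0 ≤ ∫ x, F s x ∂μ ∧ tailDist μ D (s + η) ≤ ∫ x, F s x ∂μ ∧
      ∫ x, F s x ∂μ ≤ tailDist μ D (s - η) := fun s =>
    ⟨integral_nonneg fun x => (hF01 s x).1,
      tailDist_le_integral_le hD (hFm s) (hF01 s) (hF1 s) (hF0 s)⟩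
  refine ⟨fun n => Real.exp (-(lamB / (1 - lamB / N n))) *
      ∑ i ∈ Finset.range l, (lamA * (1 - l / N n)) ^ i / (i.factorial : ℝ) - err (α n),
    fun n => Real.exp (-lamC) * Real.exp (l * (lamD / N n)) *
      ∑ i ∈ Finset.range l, lamD ^ i / (i.factorial : ℝ) + err (α n), ?_, ?_, ?_⟩
  · have e1 : Tendsto (fun n => Real.exp (-(lamB / (1 - lamB / N n)))) atTop
        (𝓝 (Real.exp (-lamB))) := by
      have h := (tendsto_const_nhds (x := lamB)).div
        ((hdiv lamB).const_sub 1) (by norm_num : (1 : ℝ) - 0 ≠ 0)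
      rw [sub_zero, div_one] at h
      exact (Real.continuous_exp.tendsto _).comp h.neg
    have e2 : Tendsto (fun n => ∑ i ∈ Finset.range l,
        (lamA * (1 - l / N n)) ^ i / (i.factorial : ℝ)) atTop
        (𝓝 (∑ i ∈ Finset.range l, lamA ^ i / (i.factorial : ℝ))) := by
      refine tendsto_finsetSum _ fun i _ => Tendsto.div_const ?_ _
      have h := (((hdiv l).const_sub 1).const_mul lamA).pow i
      rwa [sub_zero, mul_one] at h
    have h := (e1.mul e2).sub herrα
    rwa [sub_zero] at h
  · have e1 : Tendsto (fun n => Real.exp (l * (lamD / N n))) atTop (𝓝 1) := by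
      have h := (hdiv lamD).const_mul (l : ℝ)
      rw [mul_zero] at h
      have h' := (Real.continuous_exp.tendsto _).comp h
      rwa [Real.exp_zero] at h'
    have h := ((e1.const_mul (Real.exp (-lamC))).mul_const
      (∑ i ∈ Finset.range l, lamD ^ i / (i.factorial : ℝ))).add herrα
    rwa [mul_one, add_zero] at h
  · filter_upwards [h0, hm2, hp2, hN.eventually_ge_atTop l, hNr.eventually_gt_atTop lamB]
      with n h0 hm2 hp2 hlN hBN
    have hpos : (0 : ℝ) ≤ N n := Nat.cast_nonneg _
    constructor
    · refine le_trans (sub_le_sub_right ?_ _) (hlow n)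
      obtain ⟨q0, q1, q2⟩ := hpF (u n - η)
      rw [sub_add_cancel] at q1
      rw [sub_sub, ← two_mul] at q2
      exact le_bernoulliCdf_const hlN q0 (by positivity)
        (h0.1.trans (mul_le_mul_of_nonneg_left q1 hpos))
        ((mul_le_mul_of_nonneg_left q2 hpos).trans hm2.2) hBN
    · refine (hupp n).trans (add_le_add_left ?_ _)
      obtain ⟨q0, q1, q2⟩ := hpF (u n + η)
      rw [add_sub_cancel_right] at q2
      rw [add_assoc, ← two_mul] at q1
      exact bernoulliCdf_const_le (hN0 n) q0 (q2.trans measureReal_le_one)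
        (hp2.1.trans (mul_le_mul_of_nonneg_left q1 hpos))
        ((mul_le_mul_of_nonneg_left q2 hpos).trans h0.2) l

end Limits

/-! ### Removal of the approximation parameters, and the theorem. -/

section Conclusion

/-- The expression bounding the limit laws of the order statistics. -/
noncomputable def poissonBound (l : ℕ) (x y : ℝ) : ℝ :=
  Real.exp (-x) * ∑ i ∈ Finset.range l, y ^ i / (i.factorial : ℝ)

theorem continuous_poissonBound (l : ℕ) : Continuous fun p : ℝ × ℝ => poissonBound l p.1 p.2 := by
  unfold poissonBound
  fun_prop

theorem le_liminf_and_limsup_le_of_forall_bounds {P : ℕ → ℝ} (hP : ∀ n, 0 ≤ P n ∧ P n ≤ 1)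
    {L H : ℝ → ℝ} {L₀ H₀ : ℝ} (hL : Tendsto L (𝓝[>] 0) (𝓝 L₀)) (hH : Tendsto H (𝓝[>] 0) (𝓝 H₀))
    (h : ∀ η : ℝ, 0 < η → ∃ lo hi : ℕ → ℝ, Tendsto lo atTop (𝓝 (L η)) ∧
      Tendsto hi atTop (𝓝 (H η)) ∧ ∀ᶠ n in atTop, lo n ≤ P n ∧ P n ≤ hi n) :
    L₀ ≤ liminf P atTop ∧ limsup P atTop ≤ H₀ := by
  have hbb : IsBoundedUnder (· ≤ ·) atTop P := isBoundedUnder_of ⟨1, fun n => (hP n).2⟩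
  have hbc : IsBoundedUnder (· ≥ ·) atTop P := isBoundedUnder_of ⟨0, fun n => (hP n).1⟩
  constructor
  · refine le_of_tendsto hL (eventually_nhdsWithin_of_forall fun η hη => ?_)
    obtain ⟨lo, hi, hlo, -, hb⟩ := h η hη
    rw [← hlo.liminf_eq]
    exact liminf_le_liminf (hb.mono fun n hn => hn.1) hlo.isBoundedUnder_ge hbb.isCoboundedUnder_ge
  · refine ge_of_tendsto hH (eventually_nhdsWithin_of_forall fun η hη => ?_)
    obtain ⟨lo, hi, -, hhi, hb⟩ := h η hη
    rw [← hhi.limsup_eq]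
    exact limsup_le_limsup (hb.mono fun n hn => hn.2) hbc.isCoboundedUnder_le hhi.isBoundedUnder_le

/-- This derives the exact limit from the two-sided bounds with weights `w ± ε`, as `ε` tends to
`0`. -/
theorem IsSDL.isDL {X : Type*} [MeasurableSpace X] {dist : X → X → ℝ≥0∞} {μ : Measure X}
    {w v : ℝ} {D : X → ℝ} (h : IsSDL dist μ w v D) {ε : ℝ} (hε : 0 < ε) :
    IsDL dist μ (w - ε) (w + ε) v D := by
  refine ⟨h.1, (h.2.bound hε).mono fun z hz => ?_⟩
  rw [Real.norm_eq_abs, Real.norm_eq_abs, Real.abs_exp, abs_le] at hz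
  constructor <;> linarith [hz.1, hz.2]

end Conclusion

theorem mainTheorem9
    {E : Type*} [NormedAddCommGroup E] [NormedSpace ℝ E] [FiniteDimensional ℝ E]
    {G : Type*} [TopologicalSpace G] [T2Space G] [SecondCountableTopology G]
    [ChartedSpace E G] [Group G] [LieGroup 𝓘(ℝ, E) ∞ G]
    -- a right-invariant Riemannian metric on `G`
    (gm : LieRiemannianMetric E G) (hgm : IsRightInvariantMetric gm)
    -- a lattice and the invariant probability measure on the quotient
    (Γ : Subgroup G) [DiscreteTopology Γ]
    [MeasurableSpace (G ⧸ Γ)] [BorelSpace (G ⧸ Γ)]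
    (μ : Measure (G ⧸ Γ)) [IsProbabilityMeasure μ] [SMulInvariantMeasure G (G ⧸ Γ) μ]
    -- a one-parameter subgroup with an eigenbasis for its adjoint action
    (a : Multiplicative ℝ →ₜ* G)
    {d : ℕ} (ζ : Module.Basis (Fin d) ℝ (GroupLieAlgebra 𝓘(ℝ, E) G)) (γs : Fin d → ℝ)
    (hAd : ∀ (i : Fin d) (t : ℝ),
      lieAd (a (Multiplicative.ofAdd t)) (ζ i) = Real.exp (γs i * t) • ζ i)
    (γ : ℝ) (hγ : IsGreatest (Set.range γs) γ)
    -- exponential mixing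
    (k : ℕ) (hk : 1 ≤ k) (δ : ℝ) (hδ : 0 < δ)
    (hmix : ExpDecayOfCorrelations ζ μ a k δ)
    -- the times and the blocks of indices
    (m : ℕ → ℝ) (hm : ∀ j, 0 < m j)
    (ρ : ℝ) (hρ : IsLUB (Set.range fun s : ℕ => m s / m (s + 1)) ρ⁻¹)
    (hρ_lt : ρ⁻¹ < min 1 (δ / (k * γ)))
    (α β : ℕ → ℕ) (hαβ : ∀ n, α n < β n) (hα : Tendsto α atTop atTop)
    (hN : Tendsto (fun n => β n - α n) atTop atTop)
    (l : ℕ) (hl : 1 ≤ l)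
    (σ : ℝ) (hσ : σ = -m 0 / (1 / 2 * (l : ℝ) + k - 1) * (k * γ / ρ - δ))
    (hNo : (fun n => blockLength (α n) (β n)) =o[atTop]
      fun n => Real.exp (σ * ρ ^ (α n)))
    -- the observable
    (D : G ⧸ Γ → ℝ) (hD : Measurable D) :
    (∀ w v : ℝ, 0 < w → 0 < v → IsSDL (quotientDist gm Γ) μ w v D → ∀ r : ℝ,
      Tendsto (fun n => μ.real {x | orbitMax a D m (α n) (β n) l x
          ≤ threshold v r (α n) (β n)}) atTop
        (𝓝 (Real.exp (-w * Real.exp (-v * r)) *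
          ∑ i ∈ Finset.range l, (w * Real.exp (-v * r)) ^ i / (i.factorial : ℝ)))) ∧
    (∀ w₁ w₂ v : ℝ, 0 < w₁ → 0 < w₂ → 0 < v → IsDL (quotientDist gm Γ) μ w₁ w₂ v D → ∀ r : ℝ,
      Real.exp (-w₂ * Real.exp (-v * r)) *
          ∑ i ∈ Finset.range l, (w₁ * Real.exp (-v * r)) ^ i / (i.factorial : ℝ)
        ≤ liminf (fun n => μ.real {x | orbitMax a D m (α n) (β n) l x
            ≤ threshold v r (α n) (β n)}) atTop ∧
      liminf (fun n => μ.real {x | orbitMax a D m (α n) (β n) l x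
            ≤ threshold v r (α n) (β n)}) atTop
        ≤ limsup (fun n => μ.real {x | orbitMax a D m (α n) (β n) l x
            ≤ threshold v r (α n) (β n)}) atTop ∧
      limsup (fun n => μ.real {x | orbitMax a D m (α n) (β n) l x
            ≤ threshold v r (α n) (β n)}) atTop
        ≤ Real.exp (-w₁ * Real.exp (-v * r)) *
          ∑ i ∈ Finset.range l, (w₂ * Real.exp (-v * r)) ^ i / (i.factorial : ℝ)) := by
  have := topologicalGroup_of_lieGroup 𝓘(ℝ, E) ∞ (G := G)
  -- the parameters
  have hρ_inv : 0 < ρ⁻¹ := (div_pos (hm 0) (hm 1)).trans_le (hρ.1 ⟨0, rfl⟩)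
  have hρ0 : 0 < ρ := inv_pos.mp hρ_inv
  have hρ1 : 1 < ρ := (inv_lt_one₀ hρ0).mp (hρ_lt.trans_le (min_le_left _ _))
  have hk0 : (0 : ℝ) < k := Nat.cast_pos.mpr hk
  -- Otherwise `δ / (k * γ)` is nonpositive (zero when the denominator vanishes) and cannot exceed
  -- `ρ⁻¹ > 0`.
  have hkγ : 0 < k * γ := by
    by_contra hneg
    exact absurd (hρ_inv.trans (hρ_lt.trans_le (min_le_right _ _)))
      (not_lt.mpr (div_nonpos_of_nonneg_of_nonpos hδ.le (not_lt.mp hneg)))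
  have hγ0 : 0 < γ := pos_of_mul_pos_right hkγ hk0.le
  have hδρ : k * γ < δ * ρ := by
    have h := hρ_lt.trans_le (min_le_right _ _)
    rw [lt_div_iff₀ hkγ, inv_mul_lt_iff₀ hρ0, mul_comm ρ] at h
    exact h
  have hmρ : ∀ j, ρ * m j ≤ m (j + 1) := fun j => by
    have h : m j / m (j + 1) ≤ ρ⁻¹ := hρ.1 ⟨j, rfl⟩
    rw [div_le_iff₀ (hm _)] at h
    rwa [← le_inv_mul_iff₀ hρ0]
  set P : ℝ → ℝ → ℕ → ℝ := fun v r n =>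
    μ.real {x | orbitMax a D m (α n) (β n) l x ≤ threshold v r (α n) (β n)} with hPdef
  have hP01 : ∀ v r n, 0 ≤ P v r n ∧ P v r n ≤ 1 := fun v r n =>
    ⟨measureReal_nonneg, measureReal_le_one⟩
  set N : ℕ → ℕ := fun n => β n - α n + 1 with hNdef
  have hNt : Tendsto N atTop atTop := (tendsto_add_atTop_nat 1).comp hN
  have hPeq : ∀ v r, ∀ᶠ n in atTop, P v r n =
      μ.real {x | ((Finset.range (N n)).filter fun i => r + 1 / v * Real.log (N n) <
        D (a (Multiplicative.ofAdd (m (α n + i))) • x)).card < l} := by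
    intro v r
    -- Once the block has at least `l` indices, the default value in `kthLargest` plays no role.
    filter_upwards [hNt.eventually_ge_atTop l] with n hn
    have hthr : threshold v r (α n) (β n) = r + 1 / v * Real.log (N n) := by
      simp only [threshold, blockLength, hNdef]
      rw [Nat.cast_add, Nat.cast_sub (hαβ n).le, Nat.cast_one]
    simp only [hPdef, hthr]
    congr 1
    ext x
    exact orbitMax_le_iff a D m hl hn (hαβ n) x _
  have main : ∀ w₁ w₂ v : ℝ, 0 < w₁ → 0 < v → IsDL (quotientDist gm Γ) μ w₁ w₂ v D → ∀ r : ℝ,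
      poissonBound l (w₂ * Real.exp (-v * r)) (w₁ * Real.exp (-v * r)) ≤
        liminf (P v r) atTop ∧
      limsup (P v r) atTop ≤
        poissonBound l (w₁ * Real.exp (-v * r)) (w₂ * Real.exp (-v * r)) := by
    intro w₁ w₂ v hw₁ hv hDL r
    have hcont : ∀ (w w' s : ℝ), Tendsto
        (fun η => poissonBound l (w * Real.exp (-v * (r + s * η))) w') (𝓝[>] 0)
        (𝓝 (poissonBound l (w * Real.exp (-v * r)) w')) := by
      intro w w' s
      have hc : Continuous fun η => poissonBound l (w * Real.exp (-v * (r + s * η))) w' :=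
        (continuous_poissonBound l).comp
          (f := fun η : ℝ => (w * Real.exp (-v * (r + s * η)), w')) (by fun_prop)
      have h := hc.tendsto 0
      rw [mul_zero, add_zero] at h
      exact h.mono_left nhdsWithin_le_nhds
    refine le_liminf_and_limsup_le_of_forall_bounds (hP01 v r) (hcont w₂ _ (-2)) (hcont w₁ _ 2)
      fun η hη => ?_
    obtain ⟨lo, hi, hlo, hhi, hb⟩ := exists_tendsto_bounds_of_separated (μ := μ)
      (T := fun j x => a (Multiplicative.ofAdd (m j)) • x) (𝓒 := fun M f => DerivBound ζ k M 1 f)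
      (fun j => measurePreserving_smul _ μ) (fun M f hf => hf.measurable) hD
      (fun η hη => hDL.1.exists_derivBound_between hgm ζ k hD hη)
      (fun M hM => exists_tendsto_bernoulliCdf_error hAd hγ0 (fun i => hγ.2 ⟨i, rfl⟩) hmix hm hρ1
        hmρ hδρ hM) hα hNt (fun n => Nat.succ_pos _) hw₁ hv hDL.2 l r hη
    refine ⟨lo, hi, ?_, hhi, ?_⟩
    · rw [show r + -2 * η = r - 2 * η by ring]
      exact hlo
    · filter_upwards [hb, hPeq v r] with n hn hn'
      rw [hn']
      exact hn
  have hbb : ∀ v r, IsBoundedUnder (· ≤ ·) atTop (P v r) := fun v r =>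
    isBoundedUnder_of ⟨1, fun n => (hP01 v r n).2⟩
  have hbc : ∀ v r, IsBoundedUnder (· ≥ ·) atTop (P v r) := fun v r =>
    isBoundedUnder_of ⟨0, fun n => (hP01 v r n).1⟩
  have hpb : ∀ w w' v r : ℝ, Real.exp (-w * Real.exp (-v * r)) *
      ∑ i ∈ Finset.range l, (w' * Real.exp (-v * r)) ^ i / (i.factorial : ℝ) =
      poissonBound l (w * Real.exp (-v * r)) (w' * Real.exp (-v * r)) := fun w w' v r => by
    rw [neg_mul, poissonBound]
  refine ⟨fun w v hw hv hSDL r => ?_, fun w₁ w₂ v hw₁ _ hv hDL r => ?_⟩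
  · rw [hpb]
    have hcont : ∀ s s' : ℝ, Tendsto (fun ε => poissonBound l ((w + s * ε) * Real.exp (-v * r))
        ((w + s' * ε) * Real.exp (-v * r))) (𝓝[>] 0)
        (𝓝 (poissonBound l (w * Real.exp (-v * r)) (w * Real.exp (-v * r)))) := by
      intro s s'
      have hc : Continuous fun ε => poissonBound l ((w + s * ε) * Real.exp (-v * r))
          ((w + s' * ε) * Real.exp (-v * r)) := (continuous_poissonBound l).comp
            (f := fun ε : ℝ => ((w + s * ε) * Real.exp (-v * r), (w + s' * ε) * Real.exp (-v * r)))
            (by fun_prop)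
      have h := hc.tendsto 0
      simp only [mul_zero, add_zero] at h
      exact h.mono_left nhdsWithin_le_nhds
    -- `ε < w` keeps the lower weight `w - ε` positive, as `main` requires.
    have hsmall : ∀ᶠ ε in 𝓝[>] (0 : ℝ), ε ∈ Ioo 0 w := Ioo_mem_nhdsGT hw
    refine tendsto_of_le_liminf_of_limsup_le (le_of_tendsto (hcont 1 (-1)) ?_)
      (ge_of_tendsto (hcont (-1) 1) ?_) (hbb v r) (hbc v r)
    · filter_upwards [hsmall] with ε hε
      have h := (main (w - ε) (w + ε) v (sub_pos.mpr hε.2) hv (hSDL.isDL hε.1) r).1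
      rwa [one_mul, neg_one_mul, ← sub_eq_add_neg]
    · filter_upwards [hsmall] with ε hε
      have h := (main (w - ε) (w + ε) v (sub_pos.mpr hε.2) hv (hSDL.isDL hε.1) r).2
      rwa [one_mul, neg_one_mul, ← sub_eq_add_neg]
  · rw [hpb, hpb]
    obtain ⟨h1, h2⟩ := main w₁ w₂ v hw₁ hv hDL r
    exact ⟨h1, liminf_le_limsup (hbb v r) (hbc v r), h2⟩
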